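/- Let $n\ge 1$ and let $H_n=\mathbb R^n\times\mathbb R^n\times\mathbb R$ be the Heisenberg group with multiplication $(x,y,t)(x',y',t')=(x+x',\,y+y',\,t+t'+\tfrac12(x\cdot y'-x'\cdot y))$. Let $C^*(H_n)$ be its full group $C^*$-algebra, the completion of $L^1(H_n)$ in the norm $\|f\|=\sup_\pi\|\pi(f)\|_{op}$ over all unitary representations $\pi$ of $H_n$; every unitary representation extends to $C^*(H_n)$. For $\lambda\in\mathbb R^*=\mathbb R\setminus\{0\}$ let $\pi_\lambda$ be the representation on $L^2(\mathbb R^n)$ $$\pi_\lambda(x,y,t)\xi(s)=e^{-2\pi i\lambda t-2\pi i\frac{\lambda}{2}x\cdot y+2\pi i\lambda s\cdot y}\,\xi(s-x),$$ and let $\rho:C^*(H_n)\to C^*(\mathbb R^{2n})$ be given by the left regular representation $\rho(x,y,t)\varphi(x',y')=\varphi(x'-x,y'-y)$ of $H_n$ on $L^2(H_n/Z)=L^2(\mathbb R^{2n})$, where $Z$ is the centre of $H_n$ and $C^*(\mathbb R^{2n})$ is the norm closure of the operators of convolution by functions of $L^1(\mathbb R^{2n})$ on $L^2(\mathbb R^{2n})$.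 Fix a Schwartz function $\eta\in\mathcal S(\mathbb R^n)$ with $\|\eta\|_2=1$, and for $\lambda\in\mathbb R^*$, $u=(a,b)\in\mathbb R^n\times\mathbb R^n$ put $$\eta(\lambda,u)(s)=|\lambda|^{n/4}e^{2\pi i a\cdot s}\,\eta\bigl(|\lambda|^{1/2}(s+\tfrac{b}{\lambda})\bigr),\qquad s\in\mathbb R^n;$$ let $P_{\eta(\lambda,u)}$ be the orthogonal projection of $L^2(\mathbb R^n)$ onto $\mathbb C\,\eta(\lambda,u)$. For $h\in\mathcal S(\mathbb R^{2n})$ let $\hat h(a,b)=\int h(x,y)e^{-2\pi i(x\cdot a+y\cdot b)}\,dx\,dy$ and $$\nu_\lambda(h)=\int_{\mathbb R^{2n}}\hat h(u)\,P_{\eta(\lambda,u)}\,\frac{du}{|\lambda|^n}.$$ Then for every $\lambda\in\mathbb R^*$ this integral converges absolutely in operator norm for each $h\in\mathcal S(\mathbb R^{2n})$, and $\nu_\lambda$ extends (uniquely) to a bounded linear map $\nu_\lambda:C^*(\mathbb R^{2n})\to B(L^2(\mathbb R^n))$; and for every $a\in C^*(H_n)$, the operator field $A(\lambda)=\pi_\lambda(a)$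 $(\lambda\in\mathbb R^*)$, $A(0)=\rho(a)$, satisfies $$\lim_{\lambda\to0}\|A(\lambda)-\nu_\lambda(A(0))\|_{op}=0 .$$ -/

import Mathlib

open MeasureTheory Filter Topology
open scoped SchwartzMap ENNReal

noncomputable section

/-! ## Integrated forms of strongly continuous families of isometries -/

section Integrated

variable {X : Type} [TopologicalSpace X] [SecondCountableTopology X] [MeasurableSpace X]
  [OpensMeasurableSpace X]
  {H : Type*} [NormedAddCommGroup H] [InnerProductSpace ℂ H]

theorem integrable_smul_isometry (μ : Measure X) (U : X → H →ₗᵢ[ℂ] H)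
    (hU : ∀ ξ, Continuous fun x => U x ξ) {f : X → ℂ} (hf : Integrable f μ) (ξ : H) :
    Integrable (fun x => f x • U x ξ) μ := by
  refine Integrable.mono' (hf.norm.mul_const ‖ξ‖)
    (hf.aestronglyMeasurable.smul (hU ξ).aestronglyMeasurable) ?_
  exact Eventually.of_forall fun x => by simp [norm_smul]

/-- For a strongly continuous family `U` of linear isometries and `f ∈ L¹(μ)`, the operator
`ξ ↦ ∫ f(x) U(x) ξ dμ(x)`. -/
def integratedForm (μ : Measure X) (U : X → H →ₗᵢ[ℂ] H) (hU : ∀ ξ, Continuous fun x => U x ξ) :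
    Lp ℂ 1 μ →L[ℂ] H →L[ℂ] H :=
  (LinearMap.mk₂ ℂ (fun (f : Lp ℂ 1 μ) (ξ : H) => ∫ x, f x • U x ξ ∂μ)
    (fun f g ξ => by
      rw [← integral_add (integrable_smul_isometry μ U hU (L1.integrable_coeFn f) ξ)
        (integrable_smul_isometry μ U hU (L1.integrable_coeFn g) ξ)]
      refine integral_congr_ae ?_
      filter_upwards [Lp.coeFn_add f g] with x hx
      rw [hx, Pi.add_apply, add_smul])
    (fun c f ξ => by
      rw [← integral_smul]
      refine integral_congr_ae ?_
      filter_upwards [Lp.coeFn_smul c f] with x hx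
      simp [hx, mul_smul])
    (fun f ξ ζ => by
      rw [← integral_add (integrable_smul_isometry μ U hU (L1.integrable_coeFn f) ξ)
        (integrable_smul_isometry μ U hU (L1.integrable_coeFn f) ζ)]
      simp)
    (fun c f ξ => by
      rw [← integral_smul]
      refine integral_congr_ae (Eventually.of_forall fun x => ?_)
      simp [smul_comm c])).mkContinuous₂ 1 (fun f ξ => by
    refine (norm_integral_le_integral_norm _).trans (le_of_eq ?_)
    rw [L1.norm_eq_integral_norm, one_mul, ← integral_mul_const]
    simp [norm_smul])

theorem integratedForm_apply (μ : Measure X) (U : X → H →ₗᵢ[ℂ] H)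
    (hU : ∀ ξ, Continuous fun x => U x ξ) (f : Lp ℂ 1 μ) (ξ : H) :
    integratedForm μ U hU f ξ = ∫ x, f x • U x ξ ∂μ := rfl

theorem norm_integratedForm_le (μ : Measure X) (U : X → H →ₗᵢ[ℂ] H)
    (hU : ∀ ξ, Continuous fun x => U x ξ) (f : Lp ℂ 1 μ) :
    ‖integratedForm μ U hU f‖ ≤ ‖f‖ := by
  refine ContinuousLinearMap.opNorm_le_bound _ (norm_nonneg _) fun ξ => ?_
  rw [integratedForm_apply]
  refine (norm_integral_le_integral_norm _).trans (le_of_eq ?_)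
  rw [L1.norm_eq_integral_norm, ← integral_mul_const]
  simp [norm_smul]

end Integrated

/-! ## Unitary representations and the full group `C*`-algebra -/

/-- A (strongly continuous) unitary representation of `G` on the Hilbert space `H`. -/
structure UnitaryRep (G : Type) [Group G] [TopologicalSpace G]
    (H : Type*) [NormedAddCommGroup H] [InnerProductSpace ℂ H] where
  toHom : G →* (H ≃ₗᵢ[ℂ] H)
  continuous_apply : ∀ ξ : H, Continuous fun g => toHom g ξ

/-- A homomorphism from a group into the monoid of linear isometries takes unitary values. -/
def UnitaryRep.ofIsometries {G : Type} [Group G] [TopologicalSpace G]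
    {H : Type*} [NormedAddCommGroup H] [InnerProductSpace ℂ H]
    (T : G →* (H →ₗᵢ[ℂ] H)) (hT : ∀ ξ : H, Continuous fun g => T g ξ) : UnitaryRep G H where
  toHom :=
    { toFun := fun g =>
        { (T g).toLinearMap with
          invFun := T g⁻¹
          left_inv := fun ξ => by
            have h : (T g⁻¹ * T g) ξ = ξ := by rw [← map_mul]; simp
            exact h
          right_inv := fun ξ => by
            have h : (T g * T g⁻¹) ξ = ξ := by rw [← map_mul]; simp
            exact h
          norm_map' := (T g).norm_map }
      map_one' := by ext ξ; change T 1 ξ = ξ; simp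
      map_mul' := fun g h => by ext ξ; change T (g * h) ξ = T g (T h ξ); simp }
  continuous_apply := hT

section GroupCStar

variable {G : Type} [Group G] [TopologicalSpace G] [SecondCountableTopology G]
  [MeasurableSpace G] [OpensMeasurableSpace G]

/-- The integrated form `π(f) = ∫ f(g) π(g) dμ(g)` for `f ∈ L¹(G, μ)`. -/
def UnitaryRep.integrated {H : Type*} [NormedAddCommGroup H] [InnerProductSpace ℂ H]
    (π : UnitaryRep G H) (μ : Measure G) : Lp ℂ 1 μ →L[ℂ] H →L[ℂ] H :=
  integratedForm μ (fun g => (π.toHom g).toLinearIsometry) π.continuous_apply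

/-- The numbers `‖π(f)‖`, where `π` runs over the unitary representations of `G`. For second
countable `G` every vector lies in a separable invariant subspace, so Hilbert spaces in `Type`
give the same supremum as Hilbert spaces in any universe. -/
def repNorms (μ : Measure G) (f : Lp ℂ 1 μ) : Set ℝ :=
  {r | ∃ (H : Type) (_ : NormedAddCommGroup H) (_ : InnerProductSpace ℂ H) (_ : CompleteSpace H)
    (π : UnitaryRep G H), r = ‖π.integrated μ f‖}

theorem repNorms_nonempty (μ : Measure G) (f : Lp ℂ 1 μ) : (repNorms μ f).Nonempty :=
  ⟨_, ℂ, inferInstance, inferInstance, inferInstance,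
    ⟨1, fun _ => continuous_const⟩, rfl⟩

theorem repNorms_bddAbove (μ : Measure G) (f : Lp ℂ 1 μ) : BddAbove (repNorms μ f) := by
  refine ⟨‖f‖, ?_⟩
  rintro r ⟨H, _, _, _, π, rfl⟩
  exact norm_integratedForm_le μ _ _ f

/-- The `C*`-(semi)norm `‖f‖ = sup_π ‖π(f)‖` on `L¹(G, μ)`. -/
def cstarSeminorm (μ : Measure G) : Seminorm ℂ (Lp ℂ 1 μ) :=
  Seminorm.ofSMulLE (fun f => sSup (repNorms μ f))
    (by
      refine le_antisymm (csSup_le (repNorms_nonempty μ 0) ?_)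
        (Real.sSup_nonneg ?_)
      · rintro r ⟨H, _, _, _, π, rfl⟩; simp
      · rintro r ⟨H, _, _, _, π, rfl⟩; exact norm_nonneg _)
    (fun f g => by
      refine csSup_le (repNorms_nonempty μ _) ?_
      rintro r ⟨H, i1, i2, i3, π, rfl⟩
      rw [map_add]
      exact (norm_add_le _ _).trans (add_le_add
        (le_csSup (repNorms_bddAbove μ f) ⟨H, i1, i2, i3, π, rfl⟩)
        (le_csSup (repNorms_bddAbove μ g) ⟨H, i1, i2, i3, π, rfl⟩)))
    (fun c f => by
      refine csSup_le (repNorms_nonempty μ _) ?_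
      rintro r ⟨H, i1, i2, i3, π, rfl⟩
      rw [map_smul, norm_smul]
      exact mul_le_mul_of_nonneg_left
        (le_csSup (repNorms_bddAbove μ f) ⟨H, i1, i2, i3, π, rfl⟩) (norm_nonneg _))

/-- `L¹(G, μ)`, to be equipped with the `C*`-norm instead of the `L¹`-norm. -/
def L1CStar (μ : Measure G) : Type := Lp ℂ 1 μ

instance (μ : Measure G) : SeminormedAddCommGroup (L1CStar μ) :=
  (cstarSeminorm μ).toAddGroupSeminorm.toSeminormedAddCommGroup

instance (μ : Measure G) : Module ℂ (L1CStar μ) := (inferInstance : Module ℂ (Lp ℂ 1 μ))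

instance (μ : Measure G) : NormedSpace ℂ (L1CStar μ) where
  norm_smul_le c f := le_of_eq (map_smul_eq_mul (cstarSeminorm μ) c f)

/-- The (underlying Banach space of the) full group `C*`-algebra: the completion of `L¹(G, μ)` in
the `C*`-norm, where `μ` is a Haar measure of the unimodular group `G`. -/
abbrev GroupCStar (μ : Measure G) : Type := UniformSpace.Completion (L1CStar μ)

/-- The canonical map `L¹(G, μ) → C*(G)`. -/
def GroupCStar.ofL1 (μ : Measure G) (f : Lp ℂ 1 μ) : GroupCStar μ :=
  ((show L1CStar μ from f : L1CStar μ) : UniformSpace.Completion (L1CStar μ))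

variable {H : Type} [NormedAddCommGroup H] [InnerProductSpace ℂ H] [CompleteSpace H]

/-- The integrated form of `π` is a contraction for the `C*`-norm. -/
def UnitaryRep.integratedCStar (π : UnitaryRep G H) (μ : Measure G) :
    L1CStar μ →L[ℂ] H →L[ℂ] H :=
  LinearMap.mkContinuous
    { toFun := fun f => π.integrated μ f
      map_add' := fun f g => map_add (π.integrated μ) f g
      map_smul' := fun c f => map_smul (π.integrated μ) c f } 1
    (fun f => by
      rw [one_mul]
      exact le_csSup (repNorms_bddAbove μ f) ⟨H, _, _, inferInstance, π, rfl⟩)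

/-- The extension of a unitary representation `π` of `G` to `C*(G)`. -/
def UnitaryRep.lift (π : UnitaryRep G H) (μ : Measure G) : GroupCStar μ →L[ℂ] H →L[ℂ] H :=
  (π.integratedCStar μ).extend (UniformSpace.Completion.toComplL (𝕜 := ℂ) (E := L1CStar μ))

theorem UnitaryRep.lift_ofL1 (π : UnitaryRep G H) (μ : Measure G) (f : Lp ℂ 1 μ) :
    π.lift μ (GroupCStar.ofL1 μ f) = π.integrated μ f :=
  ContinuousLinearMap.extend_eq _ UniformSpace.Completion.denseRange_coe
    (UniformSpace.Completion.isUniformInducing_coe _) _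

end GroupCStar

/-! ## Translations and modulations on `L²` -/

section L2

set_option linter.unusedSectionVars false

variable {E : Type} [NormedAddCommGroup E] [NormedSpace ℝ E] [FiniteDimensional ℝ E]
  [MeasureSpace E] [BorelSpace E] [(volume : Measure E).IsAddHaarMeasure]

/-- Translation on `L²`: `ξ ↦ ξ(· - x)`. -/
def l2translate (x : E) : Lp ℂ 2 (volume : Measure E) →ₗᵢ[ℂ] Lp ℂ 2 (volume : Measure E) :=
  Lp.compMeasurePreservingₗᵢ ℂ (fun s => s - x) (measurePreserving_sub_right volume x)

theorem l2translate_ae (x : E) (ξ : Lp ℂ 2 (volume : Measure E)) :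
    l2translate x ξ =ᵐ[volume] fun s => ξ (s - x) :=
  Lp.coeFn_compMeasurePreserving ξ (measurePreserving_sub_right volume x)

theorem continuous_l2translate {Z : Type*} [TopologicalSpace Z] {x : Z → E} (hx : Continuous x)
    (ξ : Lp ℂ 2 (volume : Measure E)) : Continuous fun z => l2translate (x z) ξ := by
  have hc : Continuous fun z => (⟨fun s => s - x z, by fun_prop⟩ : C(E, E)) :=
    ContinuousMap.continuous_of_continuous_uncurry _ (by
      change Continuous fun p : Z × E => p.2 - x p.1
      fun_prop)
  exact Continuous.compMeasurePreservingLp (continuous_const (y := ξ)) hc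
    (fun z => measurePreserving_sub_right volume (x z)) (by simp)

theorem memLp_modulate {θ : E → ℝ} (hθ : Continuous θ) (ξ : Lp ℂ 2 (volume : Measure E)) :
    MemLp (fun s => (Circle.exp (θ s) : ℂ) * ξ s) 2 volume := by
  have hc : Continuous fun s => (Circle.exp (θ s) : ℂ) := by fun_prop
  refine (Lp.memLp ξ).of_le (hc.aestronglyMeasurable.mul (Lp.aestronglyMeasurable ξ)) ?_
  exact Eventually.of_forall fun s => by simp

/-- Modulation on `L²`: multiplication by the phase `e^{iθ}`. -/
def l2modulate (θ : E → ℝ) (hθ : Continuous θ) :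
    Lp ℂ 2 (volume : Measure E) →ₗᵢ[ℂ] Lp ℂ 2 (volume : Measure E) where
  toFun ξ := (memLp_modulate hθ ξ).toLp _
  map_add' ξ ζ := by
    rw [← MemLp.toLp_add]
    refine MemLp.toLp_congr _ _ ?_
    filter_upwards [Lp.coeFn_add ξ ζ] with s hs
    rw [hs, Pi.add_apply, Pi.add_apply, mul_add]
  map_smul' c ξ := by
    rw [RingHom.id_apply, ← MemLp.toLp_const_smul]
    refine MemLp.toLp_congr _ _ ?_
    filter_upwards [Lp.coeFn_smul c ξ] with s hs
    simp [hs, mul_left_comm]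
  norm_map' ξ := by
    change ‖(memLp_modulate hθ ξ).toLp _‖ = _
    rw [Lp.norm_toLp, Lp.norm_def]
    congr 1
    refine eLpNorm_congr_norm_ae (Eventually.of_forall fun s => ?_)
    simp

theorem l2modulate_ae (θ : E → ℝ) (hθ : Continuous θ) (ξ : Lp ℂ 2 (volume : Measure E)) :
    l2modulate θ hθ ξ =ᵐ[volume] fun s => (Circle.exp (θ s) : ℂ) * ξ s :=
  (memLp_modulate hθ ξ).coeFn_toLp

theorem continuous_l2modulate {Z : Type*} [TopologicalSpace Z] [FirstCountableTopology Z]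
    {θ : Z → E → ℝ} (hθ : Continuous (Function.uncurry θ)) (hθ' : ∀ z, Continuous (θ z))
    (ξ : Lp ℂ 2 (volume : Measure E)) : Continuous fun z => l2modulate (θ z) (hθ' z) ξ := by
  refine continuous_iff_continuousAt.2 fun z₀ => ?_
  rw [ContinuousAt, Lp.tendsto_Lp_iff_tendsto_eLpNorm']
  have h2 : ∀ z, eLpNorm (⇑(l2modulate (θ z) (hθ' z) ξ) - ⇑(l2modulate (θ z₀) (hθ' z₀) ξ)) 2 volume
      = (∫⁻ s, ‖((Circle.exp (θ z s) : ℂ) - Circle.exp (θ z₀ s)) * ξ s‖ₑ ^ (2 : ℝ)) ^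
        (1 / 2 : ℝ) := by
    intro z
    rw [eLpNorm_eq_lintegral_rpow_enorm_toReal (by simp) (by simp)]
    simp only [ENNReal.toReal_ofNat]
    congr 1
    refine lintegral_congr_ae ?_
    filter_upwards [l2modulate_ae (θ z) (hθ' z) ξ, l2modulate_ae (θ z₀) (hθ' z₀) ξ] with s h1 h2
    simp [h1, h2, sub_mul]
  simp only [h2]
  have h0 : (0 : ℝ≥0∞) = (∫⁻ s : E, 0) ^ (1 / 2 : ℝ) := by simp
  rw [h0]
  refine Tendsto.ennrpow_const _ ?_
  refine tendsto_lintegral_filter_of_dominated_convergence'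
    (fun s => (2 * ‖ξ s‖ₑ) ^ (2 : ℝ)) ?_ ?_ ?_ ?_
  · refine Eventually.of_forall fun z => ?_
    have hc : Continuous fun s => (Circle.exp (θ z s) : ℂ) - Circle.exp (θ z₀ s) := by
      have := hθ' z
      have := hθ' z₀
      fun_prop
    exact ((hc.aestronglyMeasurable.mul (Lp.aestronglyMeasurable ξ)).enorm).pow_const _
  · refine Eventually.of_forall fun z => Eventually.of_forall fun s => ?_
    rw [enorm_mul]
    refine ENNReal.rpow_le_rpow (mul_le_mul_left ?_ _) (by norm_num)
    refine (enorm_sub_le).trans (le_of_eq ?_)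
    rw [← ofReal_norm, ← ofReal_norm]
    simp
    norm_num
  · have h := (Lp.memLp ξ).eLpNorm_lt_top
    have h3 := lintegral_rpow_enorm_lt_top_of_eLpNorm_lt_top (by simp) (by simp) h
    simp only [ENNReal.toReal_ofNat] at h3
    simp_rw [ENNReal.mul_rpow_of_nonneg _ _ (by norm_num : (0 : ℝ) ≤ 2)]
    rw [lintegral_const_mul' _ _ (by simp)]
    exact (ENNReal.mul_lt_top (by simp) h3).ne
  · refine Eventually.of_forall fun s => ?_
    have hc : Continuous fun z => ‖((Circle.exp (θ z s) : ℂ) - Circle.exp (θ z₀ s)) * ξ s‖ₑ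
        ^ (2 : ℝ) := by
      have : Continuous fun z => θ z s := hθ.comp (by fun_prop : Continuous fun z => (z, s))
      refine ENNReal.continuous_rpow_const.comp (Continuous.enorm ?_)
      fun_prop
    have := hc.tendsto z₀
    simpa using this

theorem continuous_l2modulate_l2translate {Z : Type*} [TopologicalSpace Z] [FirstCountableTopology Z]
    {θ : Z → E → ℝ} (hθ : Continuous (Function.uncurry θ)) (hθ' : ∀ z, Continuous (θ z))
    {x : Z → E} (hx : Continuous x) (ξ : Lp ℂ 2 (volume : Measure E)) :
    Continuous fun z => l2modulate (θ z) (hθ' z) (l2translate (x z) ξ) := by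
  refine continuous_iff_continuousAt.2 fun z₀ => ?_
  have h1 := (continuous_l2modulate hθ hθ' (l2translate (x z₀) ξ)).tendsto z₀
  have h2 := (continuous_l2translate hx ξ).tendsto z₀
  rw [tendsto_iff_norm_sub_tendsto_zero] at h2
  have h3 : Tendsto (fun z => l2modulate (θ z) (hθ' z) (l2translate (x z) ξ)
      - l2modulate (θ z) (hθ' z) (l2translate (x z₀) ξ)) (𝓝 z₀) (𝓝 0) := by
    rw [tendsto_zero_iff_norm_tendsto_zero]
    simpa only [← map_sub, LinearIsometry.norm_map] using h2
  simpa [ContinuousAt] using h3.add h1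

end L2

/-! ## The Heisenberg group and its representations -/

/-- `ℝⁿ`. -/
abbrev Rn (n : ℕ) : Type := EuclideanSpace ℝ (Fin n)

/-- `ℝ²ⁿ = ℝⁿ × ℝⁿ`. -/
abbrev R2n (n : ℕ) : Type := Rn n × Rn n

instance (n : ℕ) : (volume : Measure (R2n n)).IsAddHaarMeasure :=
  inferInstanceAs (((volume : Measure (Rn n)).prod (volume : Measure (Rn n))).IsAddHaarMeasure)

/-- The Heisenberg group `H_n`; the element `(x, y, t)` is written `((x, y), t)`. -/
def Heis (n : ℕ) : Type := R2n n × ℝ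

namespace Heis

variable {n : ℕ}

instance : TopologicalSpace (Heis n) := inferInstanceAs (TopologicalSpace (R2n n × ℝ))

instance : SecondCountableTopology (Heis n) :=
  inferInstanceAs (SecondCountableTopology (R2n n × ℝ))

/-- The measure is Lebesgue measure `dx dy dt`. -/
instance : MeasureSpace (Heis n) := inferInstanceAs (MeasureSpace (R2n n × ℝ))

instance : BorelSpace (Heis n) := inferInstanceAs (BorelSpace (R2n n × ℝ))

/-- The coordinate `x`. -/
def x (g : Heis n) : Rn n := g.1.1

/-- The coordinate `y`. -/
def y (g : Heis n) : Rn n := g.1.2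

/-- The central coordinate `t`. -/
def t (g : Heis n) : ℝ := g.2

/-- The element `(x, y, t)`. -/
def mk (x y : Rn n) (t : ℝ) : Heis n := ((x, y), t)

@[simp] theorem x_mk (x y : Rn n) (t : ℝ) : (mk x y t).x = x := rfl

@[simp] theorem y_mk (x y : Rn n) (t : ℝ) : (mk x y t).y = y := rfl

@[simp] theorem t_mk (x y : Rn n) (t : ℝ) : (mk x y t).t = t := rfl

theorem ext' {g h : Heis n} (hx : g.x = h.x) (hy : g.y = h.y) (ht : g.t = h.t) : g = h :=
  Prod.ext (Prod.ext hx hy) ht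

@[fun_prop] theorem continuous_x : Continuous (x : Heis n → Rn n) :=
  continuous_fst.comp (continuous_fst (X := R2n n) (Y := ℝ))

@[fun_prop] theorem continuous_y : Continuous (y : Heis n → Rn n) :=
  continuous_snd.comp (continuous_fst (X := R2n n) (Y := ℝ))

@[fun_prop] theorem continuous_t : Continuous (t : Heis n → ℝ) :=
  continuous_snd (X := R2n n) (Y := ℝ)

instance : Mul (Heis n) where
  mul g h := mk (g.x + h.x) (g.y + h.y)
    (g.t + h.t + (1 / 2) * (inner ℝ g.x h.y - inner ℝ h.x g.y))

instance : One (Heis n) where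
  one := mk 0 0 0

instance : Inv (Heis n) where
  inv g := mk (-g.x) (-g.y) (-g.t)

@[simp] theorem x_mul (g h : Heis n) : (g * h).x = g.x + h.x := rfl

@[simp] theorem y_mul (g h : Heis n) : (g * h).y = g.y + h.y := rfl

@[simp] theorem t_mul (g h : Heis n) :
    (g * h).t = g.t + h.t + (1 / 2) * (inner ℝ g.x h.y - inner ℝ h.x g.y) := rfl

@[simp] theorem x_one : (1 : Heis n).x = 0 := rfl

@[simp] theorem y_one : (1 : Heis n).y = 0 := rfl

@[simp] theorem t_one : (1 : Heis n).t = 0 := rfl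

@[simp] theorem x_inv (g : Heis n) : (g⁻¹).x = -g.x := rfl

@[simp] theorem y_inv (g : Heis n) : (g⁻¹).y = -g.y := rfl

@[simp] theorem t_inv (g : Heis n) : (g⁻¹).t = -g.t := rfl

instance : Group (Heis n) where
  mul_assoc a b c := by
    refine ext' ?_ ?_ ?_
    · simp [add_assoc]
    · simp [add_assoc]
    · simp only [t_mul, x_mul, y_mul, inner_add_left, inner_add_right]; ring
  one_mul a := by refine ext' ?_ ?_ ?_ <;> simp
  mul_one a := by refine ext' ?_ ?_ ?_ <;> simp
  inv_mul_cancel a := by refine ext' ?_ ?_ ?_ <;> simp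

end Heis

/-- `L²(ℝⁿ)`. -/
abbrev L2Rn (n : ℕ) : Type := Lp ℂ 2 (volume : Measure (Rn n))

/-- `L²(ℝ²ⁿ)`. -/
abbrev L2R2n (n : ℕ) : Type := Lp ℂ 2 (volume : Measure (R2n n))

/-- `C*(H_n)`. -/
abbrev HeisCStar (n : ℕ) : Type := GroupCStar (volume : Measure (Heis n))

/-- The phase `-2πλt - πλ x·y + 2πλ s·y` of `π_λ(x, y, t)` at the point `s`. -/
def piPhase {n : ℕ} (l : ℝ) (g : Heis n) (s : Rn n) : ℝ :=
  -2 * Real.pi * l * g.t - 2 * Real.pi * (l / 2) * inner ℝ g.x g.y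
    + 2 * Real.pi * l * inner ℝ s g.y

theorem continuous_uncurry_piPhase {n : ℕ} (l : ℝ) :
    Continuous (Function.uncurry (piPhase (n := n) l)) := by
  unfold piPhase Function.uncurry
  fun_prop

theorem continuous_piPhase {n : ℕ} (l : ℝ) (g : Heis n) : Continuous (piPhase l g) := by
  unfold piPhase
  fun_prop

/-- The representation `π_λ` of `H_n` on `L²(ℝⁿ)`:
`(π_λ(x, y, t) ξ)(s) = e^{-2πiλt - 2πi(λ/2) x·y + 2πiλ s·y} ξ(s - x)`. -/
def piRep (n : ℕ) (l : ℝ) : UnitaryRep (Heis n) (L2Rn n) :=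
  UnitaryRep.ofIsometries
    { toFun := fun g => (l2modulate (piPhase l g) (continuous_piPhase l g)).comp (l2translate g.x)
      map_one' := by
        ext1 ξ
        refine Lp.ext ?_
        change l2modulate _ (continuous_piPhase l 1) (l2translate _ ξ) =ᵐ[volume] ξ
        filter_upwards [l2modulate_ae (piPhase l (1 : Heis n)) (continuous_piPhase l 1)
          (l2translate (1 : Heis n).x ξ), l2translate_ae (1 : Heis n).x ξ] with s h1 h2
        rw [h1, h2]
        simp [piPhase]
      map_mul' := fun g h => by
        ext1 ξ
        refine Lp.ext ?_
        change l2modulate _ (continuous_piPhase l (g * h)) (l2translate _ ξ) =ᵐ[volume]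
          l2modulate _ (continuous_piPhase l g)
            (l2translate _ (l2modulate _ (continuous_piPhase l h) (l2translate _ ξ)))
        have hq := (measurePreserving_sub_right (volume : Measure (Rn n)) g.x).quasiMeasurePreserving
        filter_upwards [l2modulate_ae (piPhase l (g * h)) (continuous_piPhase l (g * h))
            (l2translate (g * h).x ξ), l2translate_ae (g * h).x ξ,
          l2modulate_ae (piPhase l g) (continuous_piPhase l g)
            (l2translate g.x (l2modulate (piPhase l h) (continuous_piPhase l h) (l2translate h.x ξ))),
          l2translate_ae g.x (l2modulate (piPhase l h) (continuous_piPhase l h) (l2translate h.x ξ)),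
          hq.ae (l2modulate_ae (piPhase l h) (continuous_piPhase l h) (l2translate h.x ξ)),
          hq.ae (l2translate_ae h.x ξ)] with s h1 h2 h3 h4 h5 h6
        rw [h1, h2, h3, h4, h5, h6, ← mul_assoc, ← Circle.coe_mul, ← Circle.exp_add, Heis.x_mul,
          sub_sub]
        congr 3
        simp only [piPhase, Heis.t_mul, Heis.x_mul, Heis.y_mul, inner_add_left, inner_add_right,
          inner_sub_left]
        ring_nf }
    (fun ξ => continuous_l2modulate_l2translate (continuous_uncurry_piPhase l) (continuous_piPhase l)
      Heis.continuous_x ξ)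

theorem piRep_ae (n : ℕ) (l : ℝ) (g : Heis n) (ξ : L2Rn n) :
    (piRep n l).toHom g ξ =ᵐ[volume] fun s =>
      Complex.exp (-2 * Real.pi * Complex.I * l * g.t
        - 2 * Real.pi * Complex.I * (l / 2) * (inner ℝ g.x g.y : ℝ)
        + 2 * Real.pi * Complex.I * l * (inner ℝ s g.y : ℝ)) * ξ (s - g.x) := by
  change l2modulate _ (continuous_piPhase l g) (l2translate _ ξ) =ᵐ[volume] _
  filter_upwards [l2modulate_ae (piPhase l g) (continuous_piPhase l g) (l2translate g.x ξ),
    l2translate_ae g.x ξ] with s h1 h2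
  rw [h1, h2, Circle.coe_exp]
  congr 2
  simp only [piPhase]
  push_cast
  ring

/-- The representation `ρ` of `H_n` induced from the trivial character of the centre `Z`, that is,
the left regular representation on `L²(H_n / Z) = L²(ℝ²ⁿ)`:
`(ρ(x, y, t) φ)(x', y') = φ(x' - x, y' - y)`. -/
def rhoRep (n : ℕ) : UnitaryRep (Heis n) (L2R2n n) :=
  UnitaryRep.ofIsometries
    { toFun := fun g => l2translate (g.x, g.y)
      map_one' := by
        ext1 φ
        refine Lp.ext ?_
        filter_upwards [l2translate_ae ((1 : Heis n).x, (1 : Heis n).y) φ] with w h1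
        rw [h1, Heis.x_one, Heis.y_one, Prod.mk_zero_zero, sub_zero]
        rfl
      map_mul' := fun g h => by
        ext1 φ
        refine Lp.ext ?_
        change l2translate _ φ =ᵐ[volume] l2translate _ (l2translate _ φ)
        have hq := (measurePreserving_sub_right (volume : Measure (R2n n))
          (g.x, g.y)).quasiMeasurePreserving
        filter_upwards [l2translate_ae ((g * h).x, (g * h).y) φ,
          l2translate_ae (g.x, g.y) (l2translate (h.x, h.y) φ),
          hq.ae (l2translate_ae (h.x, h.y) φ)] with w h1 h2 h3
        rw [h1, h2, h3, sub_sub]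
        simp }
    (fun φ => continuous_l2translate (by fun_prop) φ)

/-! ## `C*(ℝ²ⁿ)` as an algebra of convolution operators -/

/-- The convolution operator `φ ↦ h ∗ φ = ∫ h(w) φ(· - w) dw` on `L²(ℝ²ⁿ)`, for `h ∈ L¹(ℝ²ⁿ)`. -/
def convOp (n : ℕ) : Lp ℂ 1 (volume : Measure (R2n n)) →L[ℂ] L2R2n n →L[ℂ] L2R2n n :=
  integratedForm volume l2translate (fun φ => continuous_l2translate continuous_id φ)

/-- `C*(ℝ²ⁿ)`, considered as an algebra of convolution operators on `L²(ℝ²ⁿ)`: the norm closure of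
the operators of convolution by integrable functions. -/
def CStarR2n (n : ℕ) : Submodule ℂ (L2R2n n →L[ℂ] L2R2n n) :=
  (LinearMap.range (convOp n).toLinearMap).topologicalClosure

/-- The canonical map `L¹(ℝ²ⁿ) → C*(ℝ²ⁿ)`. -/
def toCStarR2n (n : ℕ) (h : Lp ℂ 1 (volume : Measure (R2n n))) : CStarR2n n :=
  ⟨convOp n h, Submodule.le_topologicalClosure _ ⟨h, rfl⟩⟩

theorem rhoRep_integrated_mem (n : ℕ) (f : Lp ℂ 1 (volume : Measure (Heis n))) :
    (rhoRep n).integrated volume f ∈ CStarR2n n := by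
  have hf : Integrable (fun p : R2n n × ℝ => f p)
      ((volume : Measure (R2n n)).prod (volume : Measure ℝ)) := L1.integrable_coeFn f
  have hF : Integrable (fun w : R2n n => ∫ t : ℝ, f ((w, t) : R2n n × ℝ)) volume :=
    hf.integral_prod_left
  refine Submodule.le_topologicalClosure _ ⟨hF.toL1 _, ?_⟩
  ext1 φ
  change ∫ w, (hF.toL1 _) w • l2translate w φ = ∫ g : Heis n, f g • l2translate (g.x, g.y) φ
  have h1 : Integrable (fun p : R2n n × ℝ => f p • l2translate p.1 φ)
      ((volume : Measure (R2n n)).prod (volume : Measure ℝ)) :=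
    integrable_smul_isometry _ (fun p : R2n n × ℝ => l2translate p.1)
      (fun φ => continuous_l2translate continuous_fst φ) hf φ
  have h2 : ∫ g : Heis n, f g • l2translate (g.x, g.y) φ
      = ∫ w : R2n n, ∫ t : ℝ, f ((w, t) : R2n n × ℝ) • l2translate w φ :=
    integral_prod _ h1
  rw [h2]
  refine integral_congr_ae ?_
  filter_upwards [hF.coeFn_toL1] with w hw
  rw [hw, integral_smul_const]

theorem rhoRep_lift_mem (n : ℕ) (a : HeisCStar n) : (rhoRep n).lift volume a ∈ CStarR2n n := by
  induction a using UniformSpace.Completion.induction_on with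
  | hp =>
    exact (Submodule.isClosed_topologicalClosure _).preimage ((rhoRep n).lift volume).continuous
  | ih f =>
    have h := UnitaryRep.lift_ofL1 (rhoRep n) volume f
    exact (congrArg (· ∈ CStarR2n n) h).mpr (rhoRep_integrated_mem n f)

/-- `ρ : C*(H_n) → C*(ℝ²ⁿ)`. -/
def rho (n : ℕ) : HeisCStar n →L[ℂ] CStarR2n n :=
  ((rhoRep n).lift volume).codRestrict (CStarR2n n) (rhoRep_lift_mem n)

/-! ## The maps `ν_λ` -/

/-- The Fourier transform `ĥ(a, b) = ∫ h(x, y) e^{-2πi(x·a + y·b)} dx dy` on `ℝ²ⁿ`. -/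
def fourierR2n {n : ℕ} (h : R2n n → ℂ) (u : R2n n) : ℂ :=
  ∫ w : R2n n, h w *
    Complex.exp (-2 * Real.pi * Complex.I * (inner ℝ w.1 u.1 + inner ℝ w.2 u.2 : ℝ))

/-- `η(λ, a, b)(s) = |λ|^{n/4} e^{2πi a·s} η(|λ|^{1/2}(s + b/λ))`, where `u = (a, b)`. -/
def etaFun {n : ℕ} (η : 𝓢(Rn n, ℂ)) (l : ℝ) (u : R2n n) (s : Rn n) : ℂ :=
  ((|l| ^ ((n : ℝ) / 4) : ℝ) : ℂ) * Complex.exp (2 * Real.pi * Complex.I * (inner ℝ u.1 s : ℝ))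
    * η ((|l| ^ (1 / 2 : ℝ)) • (s + l⁻¹ • u.2))

theorem memLp_etaFun {n : ℕ} (η : 𝓢(Rn n, ℂ)) {l : ℝ} (hl : l ≠ 0) (u : R2n n) :
    MemLp (etaFun η l u) 2 volume := by
  have hc : Continuous (etaFun η l u) := by
    unfold etaFun
    have := η.continuous
    fun_prop
  have h0 : (|l| ^ (1 / 2 : ℝ)) ≠ 0 := (Real.rpow_pos_of_pos (abs_pos.2 hl) _).ne'
  rw [memLp_two_iff_integrable_sq_norm hc.aestronglyMeasurable]
  have h1 : Integrable (fun s => ‖η s‖ ^ 2) (volume : Measure (Rn n)) :=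
    (memLp_two_iff_integrable_sq_norm η.continuous.aestronglyMeasurable).1 (η.memLp 2 volume)
  have h2 := ((h1.comp_smul h0).comp_add_right (l⁻¹ • u.2)).const_mul
    (‖((|l| ^ ((n : ℝ) / 4) : ℝ) : ℂ)‖ ^ 2)
  refine h2.congr (Eventually.of_forall fun s => ?_)
  have h3 : ‖Complex.exp (2 * Real.pi * Complex.I * (inner ℝ u.1 s : ℝ))‖ = 1 := by
    rw [show (2 * Real.pi * Complex.I * (inner ℝ u.1 s : ℝ) : ℂ)
      = ((2 * Real.pi * inner ℝ u.1 s : ℝ) : ℂ) * Complex.I by push_cast; ring]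
    exact Complex.norm_exp_ofReal_mul_I _
  simp only [etaFun, norm_mul, h3, mul_one, mul_pow]

/-- `η(λ, u)` as a vector of `L²(ℝⁿ)`, for `λ ≠ 0`. -/
def etaVec {n : ℕ} (η : 𝓢(Rn n, ℂ)) {l : ℝ} (hl : l ≠ 0) (u : R2n n) : L2Rn n :=
  (memLp_etaFun η hl u).toLp _

/-- The orthogonal projection `P_{η(λ, u)}` onto the line `ℂ η(λ, u)`. -/
def etaProj {n : ℕ} (η : 𝓢(Rn n, ℂ)) {l : ℝ} (hl : l ≠ 0) (u : R2n n) : L2Rn n →L[ℂ] L2Rn n :=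
  (ℂ ∙ etaVec η hl u).starProjection

/-- The integrand `ĥ(u) P_{η(λ, u)} / |λ|ⁿ` of `ν_λ(h)`. -/
def nuIntegrand {n : ℕ} (η : 𝓢(Rn n, ℂ)) {l : ℝ} (hl : l ≠ 0) (h : 𝓢(R2n n, ℂ)) (u : R2n n) :
    L2Rn n →L[ℂ] L2Rn n :=
  (fourierR2n h u / ((|l| ^ n : ℝ) : ℂ)) • etaProj η hl u

open scoped Classical in
/-- The operators `ν_λ(h)`, `h ∈ C*(ℝ²ⁿ)`, for `λ ≠ 0`: the (unique) bounded linear extension to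
`C*(ℝ²ⁿ)` of the map `h ↦ ∫ ĥ(u) P_{η(λ, u)} du / |λ|ⁿ` on Schwartz functions. -/
def nu {n : ℕ} (η : 𝓢(Rn n, ℂ)) {l : ℝ} (hl : l ≠ 0) : CStarR2n n →L[ℂ] L2Rn n →L[ℂ] L2Rn n :=
  if hN : ∃ N : CStarR2n n →L[ℂ] L2Rn n →L[ℂ] L2Rn n, ∀ h : 𝓢(R2n n, ℂ),
      N (toCStarR2n n (h.toLp 1 volume)) = ∫ u, nuIntegrand η hl h u
  then hN.choose else 0

theorem denseRange_schwartz_toCStarR2n (n : ℕ) :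
    DenseRange fun h : 𝓢(R2n n, ℂ) => toCStarR2n n (h.toLp 1 volume) := by
  have h1 : DenseRange (toCStarR2n n) := by
    intro z
    have hz : (z : L2R2n n →L[ℂ] L2R2n n) ∈ closure (Set.range (convOp n)) := z.2
    rw [closure_subtype]
    rwa [← Set.range_comp]
  have h2 : DenseRange (fun h : 𝓢(R2n n, ℂ) => h.toLp 1 (volume : Measure (R2n n))) :=
    SchwartzMap.denseRange_toLpCLM ENNReal.one_ne_top
  exact h1.comp h2 ((convOp n).continuous.subtype_mk _)

/-- An operator that extends the integral formula from Schwartz functions is `ν_λ`. -/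
theorem nu_eq {n : ℕ} (η : 𝓢(Rn n, ℂ)) {l : ℝ} (hl : l ≠ 0)
    (N : CStarR2n n →L[ℂ] L2Rn n →L[ℂ] L2Rn n)
    (hN : ∀ h : 𝓢(R2n n, ℂ), N (toCStarR2n n (h.toLp 1 volume)) = ∫ u, nuIntegrand η hl h u) :
    nu η hl = N := by
  have h : ∃ N : CStarR2n n →L[ℂ] L2Rn n →L[ℂ] L2Rn n, ∀ h : 𝓢(R2n n, ℂ),
      N (toCStarR2n n (h.toLp 1 volume)) = ∫ u, nuIntegrand η hl h u := ⟨N, hN⟩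
  rw [nu, dif_pos h]
  refine DFunLike.coe_injective ((denseRange_schwartz_toCStarR2n n).equalizer
    h.choose.continuous N.continuous (funext fun g => ?_))
  exact (h.choose_spec g).trans (hN g).symm

end

/-!
The map `ν_λ` is a compression. Let `r = |λ|^{1/2}`, let `g_λ` be the `L²`-normalized dilation of
`conj η̂` by `λ / r`, and let

`W_λ ξ(x, y) = e^{-2πiλ x·y} ξ(x) g_λ(y)`,

an isometry of `L²(ℝⁿ)` into `L²(ℝ²ⁿ)` (`heisEmbedding`). Computing the integral over `y` by Fourier
inversion for `η`, one finds that the Fourier transform of `W_λ ξ` at `u` is `r^{-n} ⟪η(λ, u), ξ⟫`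
(`fourierR2n_heisEmbedding`). As convolution by a Schwartz function `h` is multiplication by `ĥ` on
the Fourier side (`inner_convOp`), this gives `ν_λ(h) = W_λ* (h ∗ ·) W_λ`
(`compression_schwartz`). The right-hand side makes sense for every operator on `L²(ℝ²ⁿ)` and is
contractive, so it is the bounded extension of `ν_λ` to `C*(ℝ²ⁿ)` (`nu_eq_compression`).

For the limit, a direct computation shows that

`‖W_λ π_λ(p) ξ - ρ(p) W_λ ξ‖ = ‖ξ‖ ‖g_λ - (time-frequency shift of g_λ)‖`

for `p = (x₀, y₀, t₀)`, where the shift consists of a translation by `y₀` and a modulation of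
frequency `λ x₀` (`norm_twistedEmbedding_piRep_sub`). Undoing the dilation turns these into a
translation by `(λ / r) y₀` and a modulation of frequency `r x₀` of the fixed function `conj η̂`, so
the error tends to `0` with `λ`, independently of `ξ` (`norm_heisEmbedding_piRep_sub`,
`continuous_defect`). Dominated convergence gives `‖π_λ(f) - W_λ* ρ(f) W_λ‖ → 0` for `f ∈ L¹(H_n)`,
and density of `L¹(H_n)` gives it on `C*(H_n)`
(`tendsto_norm_piRep_lift_sub_compression`).
-/

open scoped FourierTransform ComplexConjugate InnerProductSpace

/-! ### The Fourier transform on `ℝ²ⁿ` -/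

section Chars
variable {n : ℕ}

/-- The character `w ↦ e^{2πi(w₁·u₁ + w₂·u₂)}` of `ℝ²ⁿ` with frequency `u`. -/
noncomputable def charR2n (w u : R2n n) : ℂ :=
  (Circle.exp (2 * Real.pi * (inner ℝ w.1 u.1 + inner ℝ w.2 u.2)) : ℂ)

@[simp] theorem norm_charR2n (w u : R2n n) : ‖charR2n w u‖ = 1 := Circle.norm_coe _

theorem continuous_charR2n : Continuous fun p : R2n n × R2n n => charR2n p.1 p.2 := by
  unfold charR2n
  fun_prop

theorem charR2n_eq_exp (w u : R2n n) : charR2n w u =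
    Complex.exp (2 * Real.pi * Complex.I * (inner ℝ w.1 u.1 + inner ℝ w.2 u.2 : ℝ)) := by
  rw [charR2n, Circle.coe_exp]
  congr 1
  push_cast
  ring

theorem conj_charR2n_eq_exp (w u : R2n n) : conj (charR2n w u) =
    Complex.exp (-2 * Real.pi * Complex.I * (inner ℝ w.1 u.1 + inner ℝ w.2 u.2 : ℝ)) := by
  rw [charR2n_eq_exp, ← Complex.exp_conj]
  congr 1
  simp only [map_mul, Complex.conj_ofReal, Complex.conj_I, map_ofNat]
  ring

theorem charR2n_sub (v w u : R2n n) : charR2n (v - w) u = charR2n v u * conj (charR2n w u) := by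
  simp only [charR2n, ← Circle.coe_inv_eq_conj, ← Circle.coe_mul, ← Circle.exp_neg,
    ← Circle.exp_add, Prod.fst_sub, Prod.snd_sub, inner_sub_left]
  congr 2
  ring

theorem fourierR2n_eq_integral_conj_charR2n (h : R2n n → ℂ) (u : R2n n) :
    fourierR2n h u = ∫ w, h w * conj (charR2n w u) := by
  simp only [fourierR2n, conj_charR2n_eq_exp]

/-- `fourierR2n` is Mathlib's Fourier transform on the inner product space `WithLp 2 (ℝⁿ × ℝⁿ)`. -/
theorem fourierR2n_eq_fourier (h : R2n n → ℂ) (u : R2n n) :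
    fourierR2n h u = 𝓕 (fun v : WithLp 2 (R2n n) => h v.ofLp) (WithLp.toLp 2 u) := by
  rw [Real.fourier_eq', fourierR2n, ← (WithLp.volume_preserving_ofLp (U := Rn n)
    (V := Rn n)).integral_comp (MeasurableEquiv.toLp 2 (R2n n)).symm.measurableEmbedding]
  refine integral_congr_ae (Eventually.of_forall fun v => ?_)
  simp only [WithLp.prod_inner_apply, smul_eq_mul]
  rw [mul_comm]
  congr 2
  push_cast
  ring

/-- A Schwartz function on `ℝⁿ × ℝⁿ`, transported to the inner product space
`WithLp 2 (ℝⁿ × ℝⁿ)`. -/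
noncomputable def schwartzWithLp (h : 𝓢(R2n n, ℂ)) : 𝓢(WithLp 2 (R2n n), ℂ) :=
  SchwartzMap.compCLMOfContinuousLinearEquiv ℂ (WithLp.prodContinuousLinearEquiv 2 ℝ (Rn n) (Rn n)) h

theorem coe_schwartzWithLp (h : 𝓢(R2n n, ℂ)) : ⇑(schwartzWithLp h) = fun v => h v.ofLp := rfl

theorem fourierR2n_schwartz (h : 𝓢(R2n n, ℂ)) (u : R2n n) :
    fourierR2n h u = 𝓕 (schwartzWithLp h) (WithLp.toLp 2 u) := by
  rw [fourierR2n_eq_fourier, SchwartzMap.fourier_coe, coe_schwartzWithLp]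

theorem integrable_fourierR2n (h : 𝓢(R2n n, ℂ)) : Integrable (fourierR2n (n := n) h) := by
  simp only [funext (fourierR2n_schwartz h)]
  exact ((WithLp.volume_preserving_toLp (U := Rn n) (V := Rn n)).integrable_comp_emb
    (MeasurableEquiv.toLp 2 (R2n n)).measurableEmbedding).2 (𝓕 (schwartzWithLp h)).integrable

theorem fourierR2n_inversion (h : 𝓢(R2n n, ℂ)) (w : R2n n) :
    h w = ∫ u, fourierR2n h u * charR2n w u := by
  have h1 : h w = 𝓕⁻ (𝓕 (schwartzWithLp h)) (WithLp.toLp 2 w) := by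
    rw [FourierTransform.fourierInv_fourier_eq]; rfl
  rw [h1, SchwartzMap.fourierInv_coe, Real.fourierInv_eq',
    ← (WithLp.volume_preserving_toLp (U := Rn n) (V := Rn n)).integral_comp
      (MeasurableEquiv.toLp 2 (R2n n)).measurableEmbedding]
  refine integral_congr_ae (Eventually.of_forall fun u => ?_)
  simp only [WithLp.prod_inner_apply, smul_eq_mul]
  rw [mul_comm, charR2n_eq_exp, fourierR2n_schwartz]
  congr 2
  rw [real_inner_comm w.1, real_inner_comm w.2]
  push_cast
  ring

end Chars

/-! ### Convolution operators on the Fourier side -/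

section Conv
variable {n : ℕ}

section General
variable {E : Type*} [NormedAddCommGroup E] [NormedSpace ℝ E] [FiniteDimensional ℝ E]
  [MeasurableSpace E] [BorelSpace E] (μ : Measure E) [μ.IsAddHaarMeasure]

theorem integrable_prod_conj_mul_sub {φ ψ : E → ℂ} (hφ : Integrable φ μ) (hψ : Integrable ψ μ) :
    Integrable (fun p : E × E => conj (ψ p.2) * φ (p.2 - p.1)) (μ.prod μ) := by
  have h1 : Integrable (fun v => conj (ψ v)) μ :=
    Complex.conjLIE.toContinuousLinearEquiv.toContinuousLinearMap.integrable_comp hψ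
  have h2 := h1.mul_prod hφ
  have h3 : MeasurePreserving (fun p : E × E => (p.1, p.1 - p.2)) (μ.prod μ) (μ.prod μ) :=
    (MeasurePreserving.id μ).skew_product (g := fun v w => v - w)
      (measurable_fst.sub measurable_snd)
      (Eventually.of_forall fun v => (Measure.measurePreserving_sub_left μ v).map_eq)
  exact (h3.comp Measure.measurePreserving_swap).integrable_comp_of_integrable h2

/-- For a character `χ`, the integral against `χ` of the matrix coefficient `w ↦ ⟪ψ, φ(· - w)⟫`
factorizes. -/
theorem integral_char_mul_integral {χ : E → ℂ} (hχ : Continuous χ) (hχ1 : ∀ v, ‖χ v‖ = 1)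
    (hχs : ∀ v w, χ (v - w) = χ v * conj (χ w)) {φ ψ : E → ℂ} (hφ : Integrable φ μ)
    (hψ : Integrable ψ μ) :
    ∫ w, χ w * ∫ v, conj (ψ v) * φ (v - w) ∂μ ∂μ =
      conj (∫ v, ψ v * conj (χ v) ∂μ) * ∫ w, φ w * conj (χ w) ∂μ := by
  have hI : Integrable (fun p : E × E => χ p.1 * (conj (ψ p.2) * φ (p.2 - p.1))) (μ.prod μ) :=
    (integrable_prod_conj_mul_sub μ hφ hψ).bdd_mul (hχ.comp continuous_fst).aestronglyMeasurable
      (c := 1) (Eventually.of_forall fun p => (hχ1 p.1).le)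
  have h1 : ∀ w, χ w * ∫ v, conj (ψ v) * φ (v - w) ∂μ =
      ∫ v, χ w * (conj (ψ v) * φ (v - w)) ∂μ := fun w => (integral_const_mul _ _).symm
  simp_rw [h1]
  rw [integral_integral_swap hI, ← integral_conj, ← integral_mul_const]
  congr 1 with v
  rw [← integral_sub_left_eq_self _ μ v, ← integral_const_mul]
  congr 1 with w
  simp only [sub_sub_cancel, hχs, map_mul, Complex.conj_conj]
  ring

/-- Fubini's theorem for a continuous unimodular kernel `χ`. -/
theorem integral_integral_kernel_swap {χ : E × E → ℂ} (hχ : Continuous χ) (hχ1 : ∀ p, ‖χ p‖ = 1)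
    {F K : E → ℂ} (hF : Integrable F μ) (hK : Integrable K μ) :
    ∫ w, (∫ u, F u * χ (w, u) ∂μ) * K w ∂μ = ∫ u, F u * ∫ w, χ (w, u) * K w ∂μ ∂μ := by
  have hI : Integrable (fun p : E × E => χ p * (K p.1 * F p.2)) (μ.prod μ) :=
    (hK.mul_prod hF).bdd_mul hχ.aestronglyMeasurable
      (c := 1) (Eventually.of_forall fun p => (hχ1 p).le)
  have h1 : ∀ w, (∫ u, F u * χ (w, u) ∂μ) * K w = ∫ u, χ (w, u) * (K w * F u) ∂μ := by
    intro w
    rw [← integral_mul_const]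
    congr 1 with u
    ring
  simp_rw [h1]
  rw [integral_integral_swap hI]
  congr 1 with u
  rw [← integral_const_mul]
  congr 1 with w
  ring

end General

theorem integral_mul_integral_charR2n (h : 𝓢(R2n n, ℂ)) {K : R2n n → ℂ} (hK : Integrable K) :
    ∫ w, h w * K w = ∫ u, fourierR2n h u * ∫ w, charR2n w u * K w := by
  simp_rw [fourierR2n_inversion h]
  exact integral_integral_kernel_swap volume continuous_charR2n (fun p => norm_charR2n p.1 p.2)
    (integrable_fourierR2n h) hK

theorem inner_integratedForm {X : Type} [TopologicalSpace X] [SecondCountableTopology X]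
    [MeasurableSpace X] [OpensMeasurableSpace X] {H : Type*} [NormedAddCommGroup H]
    [InnerProductSpace ℂ H] [CompleteSpace H] (μ : Measure X) (U : X → H →ₗᵢ[ℂ] H)
    (hU : ∀ ξ, Continuous fun x => U x ξ) (f : Lp ℂ 1 μ) (ξ ζ : H) :
    ⟪ζ, integratedForm μ U hU f ξ⟫_ℂ = ∫ x, f x * ⟪ζ, U x ξ⟫_ℂ ∂μ := by
  rw [integratedForm_apply, ← integral_inner
    (integrable_smul_isometry μ U hU (L1.integrable_coeFn f) ξ)]
  simp only [inner_smul_right]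

theorem inner_l2translate (w : R2n n) (φ ψ : L2R2n n) :
    ⟪ψ, l2translate w φ⟫_ℂ = ∫ v, conj (ψ v) * φ (v - w) := by
  rw [L2.inner_def]
  refine integral_congr_ae ?_
  filter_upwards [l2translate_ae w φ] with v hv
  rw [hv, RCLike.inner_apply, mul_comm]

theorem integral_charR2n_mul_integral {φ ψ : R2n n → ℂ} (hφ : Integrable φ) (hψ : Integrable ψ)
    (u : R2n n) : ∫ w, charR2n w u * (∫ v, conj (ψ v) * φ (v - w)) =
      conj (fourierR2n ψ u) * fourierR2n φ u := by
  have hc : Continuous fun w : R2n n => charR2n w u := by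
    unfold charR2n
    fun_prop
  rw [fourierR2n_eq_integral_conj_charR2n ψ, fourierR2n_eq_integral_conj_charR2n φ]
  exact integral_char_mul_integral volume hc (fun v => norm_charR2n v u)
    (fun v w => charR2n_sub v w u) hφ hψ

/-- Convolution by a Schwartz function `h` is multiplication by `ĥ` on the Fourier side. -/
theorem inner_convOp (h : 𝓢(R2n n, ℂ)) {φ ψ : L2R2n n} (hφ : Integrable φ) (hψ : Integrable ψ) :
    ⟪ψ, convOp n (h.toLp 1 volume) φ⟫_ℂ =
      ∫ u, fourierR2n h u * (conj (fourierR2n ψ u) * fourierR2n φ u) := by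
  have hK : Integrable (fun w => ∫ v, conj (ψ v) * φ (v - w)) volume :=
    (integrable_prod_conj_mul_sub volume hφ hψ).integral_prod_left
  have h1 : ⟪ψ, convOp n (h.toLp 1 volume) φ⟫_ℂ = ∫ w, h w * (∫ v, conj (ψ v) * φ (v - w)) := by
    rw [convOp, inner_integratedForm]
    refine integral_congr_ae ?_
    filter_upwards [h.coeFn_toLp 1 volume] with w hw
    rw [hw, inner_l2translate]
  rw [h1, integral_mul_integral_charR2n h hK]
  simp_rw [integral_charR2n_mul_integral hφ hψ]

end Conv

/-! ### Dilations of `L²(ℝⁿ)` -/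

section Dilation
variable {n : ℕ}

/-- The `L²`-normalized dilation `y ↦ |c|^{n/2} k(c y)`. -/
noncomputable def dilate (c : ℝ) (k : Rn n → ℂ) (y : Rn n) : ℂ :=
  ((|c| ^ ((n : ℝ) / 2) : ℝ) : ℂ) * k (c • y)

theorem norm_toLp_sq {X : Type*} [MeasurableSpace X] {μ : Measure X} {k : X → ℂ}
    (hk : MemLp k 2 μ) : ‖hk.toLp k‖ ^ 2 = ∫ y, ‖k y‖ ^ 2 ∂μ := by
  rw [← real_inner_self_eq_norm_sq, L2.inner_def]
  refine integral_congr_ae ?_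
  filter_upwards [hk.coeFn_toLp] with y hy
  rw [hy, real_inner_self_eq_norm_sq]

theorem norm_dilate_sq (c : ℝ) (k : Rn n → ℂ) (y : Rn n) :
    ‖dilate c k y‖ ^ 2 = |c| ^ n * ‖k (c • y)‖ ^ 2 := by
  rw [dilate, norm_mul, Complex.norm_real, Real.norm_of_nonneg (by positivity), mul_pow,
    ← Real.rpow_natCast, ← Real.rpow_mul (abs_nonneg c)]
  congr 1
  rw [show (n : ℝ) / 2 * (2 : ℕ) = n by push_cast; ring, Real.rpow_natCast]

theorem memLp_dilate {c : ℝ} (hc : c ≠ 0) {k : Rn n → ℂ} (hk : MemLp k 2 volume) :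
    MemLp (dilate c k) 2 volume := by
  have hm : AEStronglyMeasurable (dilate c k) volume :=
    (hk.1.comp_quasiMeasurePreserving
      (Measure.quasiMeasurePreserving_smul volume hc)).const_mul _
  rw [memLp_two_iff_integrable_sq_norm hm]
  simp only [norm_dilate_sq]
  exact (((memLp_two_iff_integrable_sq_norm hk.1).1 hk).comp_smul hc).const_mul _

theorem integral_norm_dilate_sq {c : ℝ} (hc : c ≠ 0) (k : Rn n → ℂ) :
    ∫ y, ‖dilate c k y‖ ^ 2 = ∫ y, ‖k y‖ ^ 2 := by
  simp only [norm_dilate_sq]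
  rw [integral_const_mul, Measure.integral_comp_smul volume (fun y => ‖k y‖ ^ 2) c,
    finrank_euclideanSpace_fin, smul_eq_mul, abs_inv, abs_pow, mul_inv_cancel_left₀]
  positivity

/-- The unitary dilation of `L²(ℝⁿ)`. -/
noncomputable def l2dilate {c : ℝ} (hc : c ≠ 0) (ξ : L2Rn n) : L2Rn n :=
  (memLp_dilate hc (Lp.memLp ξ)).toLp _

theorem l2dilate_ae {c : ℝ} (hc : c ≠ 0) (ξ : L2Rn n) : l2dilate hc ξ =ᵐ[volume] dilate c ξ :=
  MemLp.coeFn_toLp _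

theorem norm_l2dilate {c : ℝ} (hc : c ≠ 0) (ξ : L2Rn n) : ‖l2dilate hc ξ‖ = ‖ξ‖ := by
  have h : ‖ξ‖ ^ 2 = ∫ y, ‖ξ y‖ ^ 2 := by
    conv_lhs => rw [← Lp.toLp_coeFn ξ (Lp.memLp ξ)]
    exact norm_toLp_sq _
  rw [← sq_eq_sq₀ (norm_nonneg _) (norm_nonneg _), h, l2dilate, norm_toLp_sq,
    integral_norm_dilate_sq hc]

theorem l2dilate_sub {c : ℝ} (hc : c ≠ 0) (ξ ζ : L2Rn n) :
    l2dilate hc (ξ - ζ) = l2dilate hc ξ - l2dilate hc ζ := by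
  refine Lp.ext ?_
  filter_upwards [l2dilate_ae hc (ξ - ζ), l2dilate_ae hc ξ, l2dilate_ae hc ζ,
    Lp.coeFn_sub (l2dilate hc ξ) (l2dilate hc ζ),
    (Measure.quasiMeasurePreserving_smul volume hc).ae (Lp.coeFn_sub ξ ζ)] with y h1 h2 h3 h4 h5
  rw [h1, h4, Pi.sub_apply, h2, h3, dilate, h5, Pi.sub_apply, mul_sub]
  rfl

/-- Modulations and translations are carried to modulations and translations by dilations. -/
theorem l2modulate_l2translate_l2dilate {c : ℝ} (hc : c ≠ 0) {θ θ' : Rn n → ℝ}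
    (hθ : Continuous θ) (hθ' : Continuous θ') (h : ∀ y, θ y = θ' (c • y)) (v : Rn n) (ξ : L2Rn n) :
    l2modulate θ hθ (l2translate v (l2dilate hc ξ)) =
      l2dilate hc (l2modulate θ' hθ' (l2translate (c • v) ξ)) := by
  have hq := Measure.quasiMeasurePreserving_smul (volume : Measure (Rn n)) hc
  refine Lp.ext ?_
  filter_upwards [l2modulate_ae θ hθ (l2translate v (l2dilate hc ξ)),
    l2translate_ae v (l2dilate hc ξ),
    (measurePreserving_sub_right volume v).quasiMeasurePreserving.ae (l2dilate_ae hc ξ),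
    l2dilate_ae hc (l2modulate θ' hθ' (l2translate (c • v) ξ)),
    hq.ae (l2modulate_ae θ' hθ' (l2translate (c • v) ξ)),
    hq.ae (l2translate_ae (c • v) ξ)] with y h1 h2 h3 h4 h5 h6
  rw [h1, h2, h3, h4, dilate, dilate, h5, h6, h, smul_sub]
  ring

end Dilation

/-! ### Tensor products of `L²` functions -/

section Tensor
variable {n : ℕ}

theorem memLp_tensor (ξ g : L2Rn n) : MemLp (fun w : R2n n => ξ w.1 * g w.2) 2 volume := by
  have hm : AEStronglyMeasurable (fun w : R2n n => ξ w.1 * g w.2) volume :=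
    (Lp.aestronglyMeasurable ξ).comp_fst.mul (Lp.aestronglyMeasurable g).comp_snd
  rw [memLp_two_iff_integrable_sq_norm hm]
  simp only [norm_mul, mul_pow]
  exact ((memLp_two_iff_integrable_sq_norm (Lp.aestronglyMeasurable ξ)).1 (Lp.memLp ξ)).mul_prod
    ((memLp_two_iff_integrable_sq_norm (Lp.aestronglyMeasurable g)).1 (Lp.memLp g))

/-- The tensor product `ξ ⊗ g ∈ L²(ℝ²ⁿ)` of `ξ, g ∈ L²(ℝⁿ)`. -/
noncomputable def l2tensor (ξ g : L2Rn n) : L2R2n n := (memLp_tensor ξ g).toLp _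

theorem l2tensor_ae (ξ g : L2Rn n) :
    l2tensor ξ g =ᵐ[volume] fun w : R2n n => ξ w.1 * g w.2 := MemLp.coeFn_toLp _

theorem norm_l2tensor (ξ g : L2Rn n) : ‖l2tensor ξ g‖ = ‖ξ‖ * ‖g‖ := by
  have h (ξ : L2Rn n) : ‖ξ‖ ^ 2 = ∫ y, ‖ξ y‖ ^ 2 := by
    conv_lhs => rw [← Lp.toLp_coeFn ξ (Lp.memLp ξ)]
    exact norm_toLp_sq _
  rw [← sq_eq_sq₀ (norm_nonneg _) (by positivity), mul_pow, h, h, l2tensor, norm_toLp_sq]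
  simp only [norm_mul, mul_pow]
  exact integral_prod_mul (fun x => ‖ξ x‖ ^ 2) (fun y => ‖g y‖ ^ 2)

theorem ae_fst {p : Rn n → Prop} (h : ∀ᵐ x, p x) : ∀ᵐ w : R2n n, p w.1 :=
  Measure.quasiMeasurePreserving_fst.ae h

theorem ae_snd {p : Rn n → Prop} (h : ∀ᵐ x, p x) : ∀ᵐ w : R2n n, p w.2 :=
  Measure.quasiMeasurePreserving_snd.ae h

theorem l2tensor_add_left (ξ ζ g : L2Rn n) :
    l2tensor (ξ + ζ) g = l2tensor ξ g + l2tensor ζ g := by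
  refine Lp.ext ?_
  filter_upwards [l2tensor_ae (ξ + ζ) g, l2tensor_ae ξ g, l2tensor_ae ζ g,
    Lp.coeFn_add (l2tensor ξ g) (l2tensor ζ g), ae_fst (Lp.coeFn_add ξ ζ)] with w h1 h2 h3 h4 h5
  rw [h1, h4, Pi.add_apply, h2, h3, h5, Pi.add_apply, add_mul]

theorem l2tensor_smul_left (c : ℂ) (ξ g : L2Rn n) : l2tensor (c • ξ) g = c • l2tensor ξ g := by
  refine Lp.ext ?_
  filter_upwards [l2tensor_ae (c • ξ) g, l2tensor_ae ξ g, Lp.coeFn_smul c (l2tensor ξ g),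
    ae_fst (Lp.coeFn_smul c ξ)] with w h1 h2 h3 h4
  rw [h1, h3, Pi.smul_apply, h2, h4, Pi.smul_apply, smul_eq_mul, smul_eq_mul, mul_assoc]

theorem l2tensor_sub_right (ξ g k : L2Rn n) :
    l2tensor ξ (g - k) = l2tensor ξ g - l2tensor ξ k := by
  refine Lp.ext ?_
  filter_upwards [l2tensor_ae ξ (g - k), l2tensor_ae ξ g, l2tensor_ae ξ k,
    Lp.coeFn_sub (l2tensor ξ g) (l2tensor ξ k), ae_snd (Lp.coeFn_sub g k)] with w h1 h2 h3 h4 h5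
  rw [h1, h4, Pi.sub_apply, h2, h3, h5, Pi.sub_apply, mul_sub]

end Tensor

/-! ### The embedding of `L²(ℝⁿ)` into `L²(ℝ²ⁿ)` -/

section Embedding
variable {n : ℕ}

theorem continuous_twist (l : ℝ) :
    Continuous fun w : R2n n => -2 * Real.pi * l * inner ℝ w.1 w.2 := by fun_prop

/-- For a unit vector `g`, the map `ξ ↦ ξ ⊗ g` is an isometry. -/
noncomputable def l2tensorIsometry (g : L2Rn n) (hg : ‖g‖ = 1) : L2Rn n →ₗᵢ[ℂ] L2R2n n where
  toFun ξ := l2tensor ξ g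
  map_add' ξ ζ := l2tensor_add_left ξ ζ g
  map_smul' c ξ := l2tensor_smul_left c ξ g
  norm_map' ξ := by
    change ‖l2tensor ξ g‖ = ‖ξ‖
    rw [norm_l2tensor, hg, mul_one]

/-- The isometry `ξ ↦ e^{-2πiλ x·y} ξ(x) g(y)` of `L²(ℝⁿ)` into `L²(ℝ²ⁿ)`, for a unit vector
`g`. -/
noncomputable def twistedEmbedding (l : ℝ) (g : L2Rn n) (hg : ‖g‖ = 1) : L2Rn n →ₗᵢ[ℂ] L2R2n n :=
  (l2modulate _ (continuous_twist l)).comp (l2tensorIsometry g hg)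

theorem twistedEmbedding_apply (l : ℝ) (g : L2Rn n) (hg : ‖g‖ = 1) (ξ : L2Rn n) :
    twistedEmbedding l g hg ξ = l2modulate _ (continuous_twist l) (l2tensor ξ g) := rfl

theorem twistedEmbedding_ae (l : ℝ) (g : L2Rn n) (hg : ‖g‖ = 1) (ξ : L2Rn n) :
    twistedEmbedding l g hg ξ =ᵐ[volume] fun w =>
      (Circle.exp (-2 * Real.pi * l * inner ℝ w.1 w.2) : ℂ) * (ξ w.1 * g w.2) := by
  filter_upwards [l2modulate_ae _ (continuous_twist l) (l2tensor ξ g), l2tensor_ae ξ g]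
    with w h1 h2
  rw [twistedEmbedding_apply, h1, h2]

theorem continuous_defectPhase (l : ℝ) (p : Heis n) : Continuous fun y : Rn n =>
    2 * Real.pi * l * (inner ℝ p.x y + (p.t - inner ℝ p.x p.y / 2)) := by fun_prop

/-- The failure of `twistedEmbedding l g` to intertwine `π_λ` with `ρ` is measured by how much the
window `g` moves under a translation by `y₀` and a modulation by `λ x₀`. -/
theorem norm_twistedEmbedding_piRep_sub (l : ℝ) (g : L2Rn n) (hg : ‖g‖ = 1) (p : Heis n)
    (ξ : L2Rn n) :
    ‖twistedEmbedding l g hg ((piRep n l).toHom p ξ) -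
        (rhoRep n).toHom p (twistedEmbedding l g hg ξ)‖ =
      ‖ξ‖ * ‖g - l2modulate _ (continuous_defectPhase l p) (l2translate p.y g)‖ := by
  set k := l2modulate _ (continuous_defectPhase l p) (l2translate p.y g) with hk
  -- Both vectors are the modulation by the same phase of a tensor product with `ξ(· - x₀)`.
  have hΘ : Continuous fun w : R2n n =>
      -2 * Real.pi * l * inner ℝ w.1 w.2 + piPhase l p w.1 := by
    have := continuous_piPhase l p
    fun_prop
  have h1 : twistedEmbedding l g hg ((piRep n l).toHom p ξ) =
      l2modulate _ hΘ (l2tensor (l2translate p.x ξ) g) := by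
    refine Lp.ext ?_
    filter_upwards [twistedEmbedding_ae l g hg ((piRep n l).toHom p ξ),
      ae_fst (l2modulate_ae _ (continuous_piPhase l p) (l2translate p.x ξ)),
      l2modulate_ae _ hΘ (l2tensor (l2translate p.x ξ) g),
      l2tensor_ae (l2translate p.x ξ) g] with w h1 h2 h3 h4
    change ((piRep n l).toHom p ξ : L2Rn n) w.1 = _ at h2
    rw [h1, h2, h3, h4, Circle.exp_add, Circle.coe_mul]
    ring
  have h2 : (rhoRep n).toHom p (twistedEmbedding l g hg ξ) =
      l2modulate _ hΘ (l2tensor (l2translate p.x ξ) k) := by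
    refine Lp.ext ?_
    filter_upwards [l2translate_ae (p.x, p.y) (twistedEmbedding l g hg ξ),
      (measurePreserving_sub_right (volume : Measure (R2n n))
          (p.x, p.y)).quasiMeasurePreserving.ae (twistedEmbedding_ae l g hg ξ),
      l2modulate_ae _ hΘ (l2tensor (l2translate p.x ξ) k),
      l2tensor_ae (l2translate p.x ξ) k, ae_fst (l2translate_ae p.x ξ),
      ae_snd (l2modulate_ae _ (continuous_defectPhase l p) (l2translate p.y g)),
      ae_snd (l2translate_ae p.y g)] with w h1 h2 h3 h4 h5 h6 h7
    change ((rhoRep n).toHom p (twistedEmbedding l g hg ξ) : L2R2n n) w = _ at h1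
    rw [h1, h2, h3, h4, h5, hk, h6, h7, Prod.fst_sub, Prod.snd_sub]
    have h8 : -2 * Real.pi * l * inner ℝ (w.1 - p.x) (w.2 - p.y) =
        (-2 * Real.pi * l * inner ℝ w.1 w.2 + piPhase l p w.1) +
          2 * Real.pi * l * (inner ℝ p.x w.2 + (p.t - inner ℝ p.x p.y / 2)) := by
      simp only [piPhase, inner_sub_left, inner_sub_right]
      ring
    rw [h8, Circle.exp_add _ (2 * Real.pi * l * _), Circle.coe_mul]
    ring
  rw [h1, h2, ← map_sub, LinearIsometry.norm_map, ← l2tensor_sub_right, norm_l2tensor,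
    LinearIsometry.norm_map]

end Embedding

/-! ### The Fourier transform of an embedded vector -/

section Window
variable {n : ℕ}

/-- The scale `|λ|^{1/2}` of the vectors `η(λ, u)`. -/
noncomputable def scale (l : ℝ) : ℝ := |l| ^ (1 / 2 : ℝ)

theorem scale_pos {l : ℝ} (hl : l ≠ 0) : 0 < scale l := Real.rpow_pos_of_pos (abs_pos.2 hl) _

theorem scale_eq_sqrt (l : ℝ) : scale l = √|l| := by rw [scale, Real.sqrt_eq_rpow]

theorem scale_sq (l : ℝ) : scale l ^ 2 = |l| := by
  rw [scale_eq_sqrt, Real.sq_sqrt (abs_nonneg l)]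

theorem scale_rpow_half (l : ℝ) : scale l ^ ((n : ℝ) / 2) = |l| ^ ((n : ℝ) / 4) := by
  rw [scale, ← Real.rpow_mul (abs_nonneg l)]
  congr 1
  ring

theorem div_scale_ne_zero {l : ℝ} (hl : l ≠ 0) : l / scale l ≠ 0 :=
  div_ne_zero hl (scale_pos hl).ne'

theorem abs_div_scale {l : ℝ} (hl : l ≠ 0) : |l / scale l| = scale l := by
  rw [abs_div, abs_of_pos (scale_pos hl), ← scale_sq, sq, mul_div_assoc,
    div_self (scale_pos hl).ne', mul_one]

/-- The function `conj η̂`, whose Fourier transform is `conj η`. -/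
noncomputable def windowFun (η : 𝓢(Rn n, ℂ)) (z : Rn n) : ℂ := conj (𝓕 η z)

theorem continuous_windowFun (η : 𝓢(Rn n, ℂ)) : Continuous (windowFun η) :=
  Complex.continuous_conj.comp (𝓕 η).continuous

theorem integrable_windowFun (η : 𝓢(Rn n, ℂ)) : Integrable (windowFun η) :=
  Complex.conjLIE.toContinuousLinearEquiv.toContinuousLinearMap.integrable_comp (𝓕 η).integrable

theorem memLp_windowFun (η : 𝓢(Rn n, ℂ)) : MemLp (windowFun η) 2 volume :=
  ((𝓕 η).memLp 2 volume).of_le (continuous_windowFun η).aestronglyMeasurable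
    (Eventually.of_forall fun z => by simp [windowFun])

theorem fourier_windowFun (η : 𝓢(Rn n, ℂ)) (v : Rn n) : 𝓕 (windowFun η) v = conj (η v) := by
  have h : η v = 𝓕⁻ (𝓕 η) v := by rw [FourierTransform.fourierInv_fourier_eq]
  rw [h, SchwartzMap.fourierInv_coe, Real.fourierInv_eq', Real.fourier_eq', ← integral_conj]
  congr 1 with z
  simp only [windowFun, smul_eq_mul, map_mul, ← Complex.exp_conj, Complex.conj_ofReal,
    Complex.conj_I]
  congr 2
  push_cast
  ring

/-- The window `conj η̂` as a vector of `L²(ℝⁿ)`. -/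
noncomputable def windowVec (η : 𝓢(Rn n, ℂ)) : L2Rn n := (memLp_windowFun η).toLp _

theorem norm_windowVec {η : 𝓢(Rn n, ℂ)} (hη : ∫ s, ‖η s‖ ^ 2 = 1) : ‖windowVec η‖ = 1 := by
  rw [← sq_eq_sq₀ (norm_nonneg _) zero_le_one, windowVec, norm_toLp_sq]
  simp only [windowFun, RCLike.norm_conj]
  rw [SchwartzMap.integral_norm_sq_fourier, hη, one_pow]

/-- The embedding `W_λ ξ(x, y) = e^{-2πiλ x·y} ξ(x) g_λ(y)` of `L²(ℝⁿ)` into `L²(ℝ²ⁿ)`, where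
`g_λ` is the dilation of `conj η̂` by `λ / |λ|^{1/2}`. -/
noncomputable def heisEmbedding {η : 𝓢(Rn n, ℂ)} (hη : ∫ s, ‖η s‖ ^ 2 = 1) {l : ℝ} (hl : l ≠ 0) :
    L2Rn n →ₗᵢ[ℂ] L2R2n n :=
  twistedEmbedding l (l2dilate (div_scale_ne_zero hl) (windowVec η))
    (by rw [norm_l2dilate, norm_windowVec hη])

theorem heisEmbedding_ae {η : 𝓢(Rn n, ℂ)} (hη : ∫ s, ‖η s‖ ^ 2 = 1) {l : ℝ} (hl : l ≠ 0)
    (ξ : L2Rn n) : heisEmbedding hη hl ξ =ᵐ[volume] fun w =>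
      (Circle.exp (-2 * Real.pi * l * inner ℝ w.1 w.2) : ℂ) *
        (ξ w.1 * dilate (l / scale l) (windowFun η) w.2) := by
  have hc := div_scale_ne_zero hl
  filter_upwards [twistedEmbedding_ae l (l2dilate hc (windowVec η))
      (by rw [norm_l2dilate, norm_windowVec hη]) ξ,
    ae_snd (l2dilate_ae hc (windowVec η)),
    ae_snd ((Measure.quasiMeasurePreserving_smul volume hc).ae
      (memLp_windowFun η).coeFn_toLp)] with w h1 h2 h3
  change heisEmbedding hη hl ξ w = _ at h1
  rw [h1, h2, dilate, dilate, windowVec, h3]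

theorem integrable_dilate {c : ℝ} (hc : c ≠ 0) {k : Rn n → ℂ} (hk : Integrable k) :
    Integrable (dilate c k) :=
  (hk.comp_smul hc).const_mul _

theorem integrable_heisEmbedding {η : 𝓢(Rn n, ℂ)} (hη : ∫ s, ‖η s‖ ^ 2 = 1) {l : ℝ}
    (hl : l ≠ 0) {ξ : L2Rn n} (hξ : Integrable ξ) : Integrable (heisEmbedding hη hl ξ) := by
  rw [integrable_congr (heisEmbedding_ae hη hl ξ)]
  have hc : Continuous fun w : R2n n =>
      (Circle.exp (-2 * Real.pi * l * inner ℝ w.1 w.2) : ℂ) := by fun_prop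
  exact (hξ.mul_prod (integrable_dilate (div_scale_ne_zero hl) (integrable_windowFun η))).bdd_mul
    hc.aestronglyMeasurable (c := 1) (Eventually.of_forall fun w => (Circle.norm_coe _).le)

theorem fourier_dilate {c : ℝ} (hc : c ≠ 0) (k : Rn n → ℂ) (v : Rn n) :
    𝓕 (dilate c k) v = ((|c| ^ ((n : ℝ) / 2) * (|c| ^ n)⁻¹ : ℝ) : ℂ) * 𝓕 k (c⁻¹ • v) := by
  rw [Real.fourier_eq', Real.fourier_eq']
  have h1 (y : Rn n) : Complex.exp (((-2 * Real.pi * inner ℝ y v : ℝ) : ℂ) * Complex.I) •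
      dilate c k y = ((|c| ^ ((n : ℝ) / 2) : ℝ) : ℂ) *
        (fun z => Complex.exp (((-2 * Real.pi * inner ℝ z (c⁻¹ • v) : ℝ) : ℂ) * Complex.I) • k z)
          (c • y) := by
    have h2 : inner ℝ (c • y) (c⁻¹ • v) = inner ℝ y v := by
      rw [real_inner_smul_left, real_inner_smul_right, mul_inv_cancel_left₀ hc]
    simp only [h2, dilate, smul_eq_mul]
    ring
  simp_rw [h1]
  rw [integral_const_mul, Measure.integral_comp_smul volume
    (fun z => Complex.exp (((-2 * Real.pi * inner ℝ z (c⁻¹ • v) : ℝ) : ℂ) * Complex.I) • k z),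
    finrank_euclideanSpace_fin, abs_inv, abs_pow, Complex.real_smul,
    Complex.ofReal_mul, mul_assoc]

/-- On the Fourier side, `W_λ` is the transform `ξ ↦ ⟪η(λ, u), ξ⟫`, up to a constant. -/
theorem fourierR2n_heisEmbedding {η : 𝓢(Rn n, ℂ)} (hη : ∫ s, ‖η s‖ ^ 2 = 1) {l : ℝ}
    (hl : l ≠ 0) {ξ : L2Rn n} (hξ : Integrable ξ) (u : R2n n) :
    fourierR2n (heisEmbedding hη hl ξ) u =
      (((scale l ^ n)⁻¹ : ℝ) : ℂ) * ⟪etaVec η hl u, ξ⟫_ℂ := by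
  set g := dilate (l / scale l) (windowFun η) with hg
  have hgi : Integrable g := integrable_dilate (div_scale_ne_zero hl) (integrable_windowFun η)
  have hr := scale_pos hl
  -- For fixed `x` the twist `e^{-2πiλ x·y}` shifts the frequency, so that the integral over `y` is
  -- the Fourier transform of the dilated window at `u.2 + λ x`, that is, a value of `conj η`.
  have h1 (x : Rn n) : ∫ y : Rn n, (Circle.exp (-2 * Real.pi * l * inner ℝ x y) : ℂ) *
      (ξ x * g y) * conj (charR2n (x, y) u) =
      (((scale l ^ n)⁻¹ : ℝ) : ℂ) * (conj (etaFun η l u x) * ξ x) := by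
    have h2 (y : Rn n) : (Circle.exp (-2 * Real.pi * l * inner ℝ x y) : ℂ) *
        (ξ x * g y) * conj (charR2n (x, y) u) =
        ξ x * (Circle.exp (-(2 * Real.pi * inner ℝ u.1 x)) : ℂ) *
          (Complex.exp (((-2 * Real.pi * inner ℝ y (u.2 + l • x) : ℝ) : ℂ) * Complex.I) • g y) := by
      have h3 : (Circle.exp (-2 * Real.pi * l * inner ℝ x y) : ℂ) * conj (charR2n (x, y) u) =
          (Circle.exp (-(2 * Real.pi * inner ℝ u.1 x)) : ℂ) *
            Complex.exp (((-2 * Real.pi * inner ℝ y (u.2 + l • x) : ℝ) : ℂ) * Complex.I) := by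
        rw [← Circle.coe_exp, charR2n, ← Circle.coe_inv_eq_conj, ← Circle.exp_neg,
          ← Circle.coe_mul, ← Circle.coe_mul, ← Circle.exp_add, ← Circle.exp_add]
        congr 2
        rw [inner_add_right, real_inner_smul_right, real_inner_comm x u.1, real_inner_comm x y]
        ring
      rw [smul_eq_mul]
      linear_combination (ξ x * g y) * h3
    simp_rw [h2]
    rw [integral_const_mul, ← Real.fourier_eq', hg, fourier_dilate (div_scale_ne_zero hl),
      fourier_windowFun, abs_div_scale hl, etaFun, scale_rpow_half]
    have h4 : (l / scale l)⁻¹ • (u.2 + l • x) = (|l| ^ (1 / 2 : ℝ)) • (x + l⁻¹ • u.2) := by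
      change _ = scale l • _
      rw [smul_add, smul_add, smul_smul, smul_smul, inv_div, div_mul_cancel₀ _ hl, div_eq_mul_inv,
        add_comm]
    have h5 : conj (Complex.exp (2 * Real.pi * Complex.I * (inner ℝ u.1 x : ℝ))) =
        (Circle.exp (-(2 * Real.pi * inner ℝ u.1 x)) : ℂ) := by
      rw [← Complex.exp_conj, Circle.coe_exp]
      congr 1
      simp only [map_mul, Complex.conj_ofReal, Complex.conj_I, map_ofNat]
      push_cast
      ring
    rw [h4, map_mul, map_mul, h5, Complex.conj_ofReal]
    push_cast
    ring
  have hI : Integrable (fun w : R2n n => (Circle.exp (-2 * Real.pi * l * inner ℝ w.1 w.2) : ℂ) *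
      (ξ w.1 * g w.2) * conj (charR2n w u)) volume := by
    have h2 := (integrable_congr (heisEmbedding_ae hη hl ξ)).1 (integrable_heisEmbedding hη hl hξ)
    have hc : Continuous fun w : R2n n => conj (charR2n w u) := by
      unfold charR2n
      fun_prop
    exact h2.mul_bdd hc.aestronglyMeasurable (c := 1) (Eventually.of_forall fun w => by simp)
  calc fourierR2n (heisEmbedding hη hl ξ) u
      = ∫ w : R2n n, (Circle.exp (-2 * Real.pi * l * inner ℝ w.1 w.2) : ℂ) *
          (ξ w.1 * g w.2) * conj (charR2n w u) := by
        rw [fourierR2n_eq_integral_conj_charR2n]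
        refine integral_congr_ae ?_
        filter_upwards [heisEmbedding_ae hη hl ξ] with w hw
        rw [hw]
    _ = ∫ x : Rn n, ∫ y : Rn n, (Circle.exp (-2 * Real.pi * l * inner ℝ x y) : ℂ) *
          (ξ x * g y) * conj (charR2n (x, y) u) := integral_prod _ hI
    _ = ∫ x : Rn n, (((scale l ^ n)⁻¹ : ℝ) : ℂ) * (conj (etaFun η l u x) * ξ x) := by
        simp_rw [h1]
    _ = (((scale l ^ n)⁻¹ : ℝ) : ℂ) * ⟪etaVec η hl u, ξ⟫_ℂ := by
        rw [integral_const_mul, L2.inner_def]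
        congr 1
        refine integral_congr_ae ?_
        filter_upwards [(memLp_etaFun η hl u).coeFn_toLp] with x hx
        rw [etaVec, hx, RCLike.inner_apply, mul_comm]

end Window

/-! ### The maps `ν_λ` as compressions -/

section CoherentStates
variable {n : ℕ}

/-- `η(λ, u)` is a time-frequency shift of a dilation of `η`. -/
theorem etaVec_eq (η : 𝓢(Rn n, ℂ)) {l : ℝ} (hl : l ≠ 0) (u : R2n n) :
    etaVec η hl u = l2modulate (fun s => 2 * Real.pi * inner ℝ u.1 s) (by fun_prop)
      (l2translate (-(l⁻¹ • u.2)) (l2dilate (scale_pos hl).ne' (η.toLp 2 volume))) := by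
  have hc := (scale_pos hl).ne'
  have hq := (measurePreserving_sub_right (volume : Measure (Rn n))
    (-(l⁻¹ • u.2))).quasiMeasurePreserving
  refine Lp.ext ?_
  filter_upwards [(memLp_etaFun η hl u).coeFn_toLp,
    l2modulate_ae (fun s => 2 * Real.pi * inner ℝ u.1 s) (by fun_prop)
      (l2translate (-(l⁻¹ • u.2)) (l2dilate hc (η.toLp 2 volume))),
    l2translate_ae (-(l⁻¹ • u.2)) (l2dilate hc (η.toLp 2 volume)),
    hq.ae (l2dilate_ae hc (η.toLp 2 volume)),
    hq.ae ((Measure.quasiMeasurePreserving_smul volume hc).ae (η.coeFn_toLp 2 volume))]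
    with s h1 h2 h3 h4 h5
  rw [etaVec, h1, h2, h3, h4, dilate, h5, etaFun, abs_of_pos (scale_pos hl), scale_rpow_half,
    Circle.coe_exp, sub_neg_eq_add, scale]
  have h6 : ((2 * Real.pi * inner ℝ u.1 s : ℝ) : ℂ) * Complex.I =
      2 * Real.pi * Complex.I * (inner ℝ u.1 s : ℝ) := by
    push_cast
    ring
  rw [h6]
  ring

theorem norm_etaVec {η : 𝓢(Rn n, ℂ)} (hη : ∫ s, ‖η s‖ ^ 2 = 1) {l : ℝ} (hl : l ≠ 0)
    (u : R2n n) : ‖etaVec η hl u‖ = 1 := by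
  rw [etaVec_eq, LinearIsometry.norm_map, LinearIsometry.norm_map, norm_l2dilate,
    ← sq_eq_sq₀ (norm_nonneg _) zero_le_one, SchwartzMap.toLp, norm_toLp_sq, hη, one_pow]

theorem continuous_etaVec (η : 𝓢(Rn n, ℂ)) {l : ℝ} (hl : l ≠ 0) : Continuous (etaVec η hl) := by
  rw [funext (etaVec_eq η hl)]
  exact continuous_l2modulate_l2translate (Z := R2n n)
    (θ := fun u s => 2 * Real.pi * inner ℝ u.1 s)
    (by unfold Function.uncurry; fun_prop) (fun u => by fun_prop)
    (x := fun u => -(l⁻¹ • u.2)) (by fun_prop) _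

/-- Since `η(λ, u)` is a unit vector, the projection is `ξ ↦ ⟪η(λ, u), ξ⟫ η(λ, u)`. -/
theorem etaProj_eq {η : 𝓢(Rn n, ℂ)} (hη : ∫ s, ‖η s‖ ^ 2 = 1) {l : ℝ} (hl : l ≠ 0)
    (u : R2n n) : etaProj η hl u =
      (innerSL ℂ (etaVec η hl u)).smulRight (etaVec η hl u) := by
  ext1 ξ
  rw [etaProj, Submodule.starProjection_unit_singleton ℂ (norm_etaVec hη hl u)]
  rfl

theorem continuous_etaProj {η : 𝓢(Rn n, ℂ)} (hη : ∫ s, ‖η s‖ ^ 2 = 1) {l : ℝ} (hl : l ≠ 0) :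
    Continuous (etaProj η hl) := by
  rw [funext (etaProj_eq hη hl)]
  have h1 := continuous_etaVec η hl
  have h2 : Continuous fun u => innerSL ℂ (etaVec η hl u) := (innerSL ℂ).continuous.comp h1
  exact ((ContinuousLinearMap.smulRightL ℂ (L2Rn n) (L2Rn n)).continuous.comp h2).clm_apply h1

theorem integrable_nuIntegrand {η : 𝓢(Rn n, ℂ)} (hη : ∫ s, ‖η s‖ ^ 2 = 1) {l : ℝ} (hl : l ≠ 0)
    (h : 𝓢(R2n n, ℂ)) : Integrable (nuIntegrand η hl h) volume :=
  ((integrable_fourierR2n h).div_const _).smul_bdd 1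
    (continuous_etaProj hη hl).aestronglyMeasurable
    (Eventually.of_forall fun _ => Submodule.starProjection_norm_le _)

/-- The compression `T ↦ W_λ* T W_λ` of operators on `L²(ℝ²ⁿ)` to `L²(ℝⁿ)`, restricted to
`C*(ℝ²ⁿ)`. -/
noncomputable def compression {η : 𝓢(Rn n, ℂ)} (hη : ∫ s, ‖η s‖ ^ 2 = 1) {l : ℝ} (hl : l ≠ 0) :
    CStarR2n n →L[ℂ] L2Rn n →L[ℂ] L2Rn n :=
  (ContinuousLinearMap.compL ℂ (L2Rn n) (L2R2n n) (L2Rn n)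
      (ContinuousLinearMap.adjoint (heisEmbedding hη hl).toContinuousLinearMap)) ∘L
    ((ContinuousLinearMap.compL ℂ (L2Rn n) (L2R2n n) (L2R2n n)).flip
      (heisEmbedding hη hl).toContinuousLinearMap) ∘L (CStarR2n n).subtypeL

theorem compression_apply {η : 𝓢(Rn n, ℂ)} (hη : ∫ s, ‖η s‖ ^ 2 = 1) {l : ℝ} (hl : l ≠ 0)
    (T : CStarR2n n) : compression hη hl T =
      ContinuousLinearMap.adjoint (heisEmbedding hη hl).toContinuousLinearMap ∘L
        (T : L2R2n n →L[ℂ] L2R2n n) ∘L (heisEmbedding hη hl).toContinuousLinearMap := rfl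

theorem inner_compression {η : 𝓢(Rn n, ℂ)} (hη : ∫ s, ‖η s‖ ^ 2 = 1) {l : ℝ} (hl : l ≠ 0)
    (T : CStarR2n n) (ξ ζ : L2Rn n) : ⟪ζ, compression hη hl T ξ⟫_ℂ =
      ⟪heisEmbedding hη hl ζ, (T : L2R2n n →L[ℂ] L2R2n n) (heisEmbedding hη hl ξ)⟫_ℂ := by
  rw [compression_apply, ContinuousLinearMap.comp_apply, ContinuousLinearMap.adjoint_inner_right]
  rfl

theorem inner_nuIntegrand {η : 𝓢(Rn n, ℂ)} (hη : ∫ s, ‖η s‖ ^ 2 = 1) {l : ℝ} (hl : l ≠ 0)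
    (h : 𝓢(R2n n, ℂ)) (u : R2n n) (ξ ζ : L2Rn n) : ⟪ζ, nuIntegrand η hl h u ξ⟫_ℂ =
      fourierR2n h u / ((|l| ^ n : ℝ) : ℂ) *
        (⟪etaVec η hl u, ξ⟫_ℂ * conj ⟪etaVec η hl u, ζ⟫_ℂ) := by
  rw [nuIntegrand, etaProj_eq hη, smul_apply, inner_smul_right,
    ContinuousLinearMap.smulRight_apply, inner_smul_right, innerSL_apply_apply, inner_conj_symm]

theorem inner_integral_nuIntegrand {η : 𝓢(Rn n, ℂ)} (hη : ∫ s, ‖η s‖ ^ 2 = 1) {l : ℝ}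
    (hl : l ≠ 0) (h : 𝓢(R2n n, ℂ)) (ξ ζ : L2Rn n) :
    ⟪ζ, (∫ u, nuIntegrand η hl h u) ξ⟫_ℂ = ∫ u, ⟪ζ, nuIntegrand η hl h u ξ⟫_ℂ := by
  have hF := integrable_nuIntegrand hη hl h
  rw [ContinuousLinearMap.integral_apply hF]
  exact ((innerSL ℂ ζ).integral_comp_comm (hF.apply_continuousLinearMap ξ)).symm

/-- On convolutions by Schwartz functions the compression is the integral that defines `ν_λ`. It
suffices to compare matrix coefficients at Schwartz functions, which lie in `L¹ ∩ L²`, so that the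
Fourier transforms are given by integrals. -/
theorem compression_schwartz {η : 𝓢(Rn n, ℂ)} (hη : ∫ s, ‖η s‖ ^ 2 = 1) {l : ℝ} (hl : l ≠ 0)
    (h : 𝓢(R2n n, ℂ)) :
    compression hη hl (toCStarR2n n (h.toLp 1 volume)) = ∫ u, nuIntegrand η hl h u := by
  have hd : DenseRange (fun f : 𝓢(Rn n, ℂ) => f.toLp 2 (volume : Measure (Rn n))) :=
    SchwartzMap.denseRange_toLpCLM (p := 2) ENNReal.ofNat_ne_top
  have hS (f : 𝓢(Rn n, ℂ)) : Integrable (f.toLp 2 (volume : Measure (Rn n))) :=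
    (integrable_congr (f.coeFn_toLp 2 volume)).2 f.integrable
  refine DFunLike.coe_injective (hd.equalizer (ContinuousLinearMap.continuous _)
    (ContinuousLinearMap.continuous _) (funext fun f => ?_))
  refine hd.eq_of_inner_right (𝕜 := ℂ) fun g => ?_
  simp only [Function.comp_apply]
  rw [inner_compression, inner_integral_nuIntegrand hη hl h, toCStarR2n,
    inner_convOp h (integrable_heisEmbedding hη hl (hS f)) (integrable_heisEmbedding hη hl (hS g))]
  congr 1 with u
  rw [inner_nuIntegrand hη, fourierR2n_heisEmbedding hη hl (hS f),
    fourierR2n_heisEmbedding hη hl (hS g), map_mul, Complex.conj_ofReal, ← scale_sq l, ← pow_mul, mul_comm 2 n,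
    pow_mul]
  have := (scale_pos hl).ne'
  push_cast
  field_simp

theorem nu_eq_compression {η : 𝓢(Rn n, ℂ)} (hη : ∫ s, ‖η s‖ ^ 2 = 1) {l : ℝ} (hl : l ≠ 0) :
    nu η hl = compression hη hl :=
  nu_eq η hl _ (compression_schwartz hη hl)

end CoherentStates

/-! ### The failure of the embedding to intertwine `π_λ` and `ρ` -/

section Defect
variable {n : ℕ}

/-- The distance from the window `conj η̂` to its time-frequency shift that measures how far
`W_λ` is from intertwining `π_λ(p)` with `ρ(p)`. The parameters `q = (λ, |λ|^{1/2}, λ/|λ|^{1/2})`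
are kept independent, so that the defect is visibly continuous at `q = 0`. -/
noncomputable def defect (η : 𝓢(Rn n, ℂ)) (p : Heis n) (q : ℝ × ℝ × ℝ) : ℝ :=
  ‖windowVec η - l2modulate
    (fun z : Rn n => 2 * Real.pi * (q.2.1 * inner ℝ p.x z + q.1 * (p.t - inner ℝ p.x p.y / 2)))
    (by fun_prop) (l2translate (q.2.2 • p.y) (windowVec η))‖

theorem continuous_defect (η : 𝓢(Rn n, ℂ)) :
    Continuous fun z : Heis n × ℝ × ℝ × ℝ => defect η z.1 z.2 := by
  have hfst : Continuous (Prod.fst : Heis n × ℝ × ℝ × ℝ → Heis n) := continuous_fst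
  have hx := Heis.continuous_x.comp hfst
  have hy := Heis.continuous_y.comp hfst
  have ht := Heis.continuous_t.comp hfst
  simp only [Function.comp_def] at hx hy ht
  have : FirstCountableTopology (Heis n) :=
    inferInstanceAs (FirstCountableTopology (R2n n × ℝ))
  refine (continuous_const.sub (continuous_l2modulate_l2translate (Z := Heis n × ℝ × ℝ × ℝ)
    (θ := fun p z => 2 * Real.pi * (p.2.2.1 * inner ℝ p.1.x z +
      p.2.1 * (p.1.t - inner ℝ p.1.x p.1.y / 2))) ?_ (fun p => by fun_prop)
    (x := fun p => p.2.2.2 • p.1.y) ?_ (windowVec η))).norm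
  · have hx' : Continuous fun a : (Heis n × ℝ × ℝ × ℝ) × Rn n => a.1.1.x := hx.comp continuous_fst
    have hy' : Continuous fun a : (Heis n × ℝ × ℝ × ℝ) × Rn n => a.1.1.y := hy.comp continuous_fst
    have ht' : Continuous fun a : (Heis n × ℝ × ℝ × ℝ) × Rn n => a.1.1.t := ht.comp continuous_fst
    unfold Function.uncurry
    fun_prop
  · fun_prop

theorem defect_zero (η : 𝓢(Rn n, ℂ)) (p : Heis n) : defect η p 0 = 0 := by
  rw [defect, norm_eq_zero, sub_eq_zero]
  refine Lp.ext ?_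
  filter_upwards [l2modulate_ae (fun z : Rn n => 2 * Real.pi * ((0 : ℝ × ℝ × ℝ).2.1 * inner ℝ p.x z
      + (0 : ℝ × ℝ × ℝ).1 * (p.t - inner ℝ p.x p.y / 2))) (by fun_prop)
      (l2translate ((0 : ℝ × ℝ × ℝ).2.2 • p.y) (windowVec η)),
    l2translate_ae ((0 : ℝ × ℝ × ℝ).2.2 • p.y) (windowVec η)] with z h1 h2
  rw [h1, h2]
  simp

theorem defect_le_two {η : 𝓢(Rn n, ℂ)} (hη : ∫ s, ‖η s‖ ^ 2 = 1) (p : Heis n) (q : ℝ × ℝ × ℝ) :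
    defect η p q ≤ 2 := by
  refine (norm_sub_le _ _).trans (le_of_eq ?_)
  rw [LinearIsometry.norm_map, LinearIsometry.norm_map, norm_windowVec hη]
  norm_num

/-- The parameters `(λ, |λ|^{1/2}, λ/|λ|^{1/2})`. -/
noncomputable def scaleParams (l : ℝ) : ℝ × ℝ × ℝ := (l, scale l, l / scale l)

theorem tendsto_scaleParams : Tendsto (fun l : {l : ℝ // l ≠ 0} => scaleParams l)
    (comap Subtype.val (𝓝 0)) (𝓝 0) := by
  have h1 : Tendsto (fun l : {l : ℝ // l ≠ 0} => (l : ℝ)) (comap Subtype.val (𝓝 0)) (𝓝 0) :=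
    tendsto_comap
  have h2 : Tendsto (fun l : {l : ℝ // l ≠ 0} => scale l) (comap Subtype.val (𝓝 0)) (𝓝 0) := by
    have h : Tendsto (fun l : ℝ => √|l|) (𝓝 0) (𝓝 0) := by
      have hc : Continuous fun l : ℝ => √|l| := by fun_prop
      simpa using hc.tendsto 0
    simp only [scale_eq_sqrt]
    exact h.comp h1
  refine h1.prodMk_nhds (h2.prodMk_nhds ?_)
  rw [tendsto_zero_iff_abs_tendsto_zero]
  exact h2.congr fun l => (abs_div_scale l.2).symm

theorem norm_heisEmbedding_piRep_sub {η : 𝓢(Rn n, ℂ)} (hη : ∫ s, ‖η s‖ ^ 2 = 1) {l : ℝ}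
    (hl : l ≠ 0) (p : Heis n) (ξ : L2Rn n) :
    ‖heisEmbedding hη hl ((piRep n l).toHom p ξ) - (rhoRep n).toHom p (heisEmbedding hη hl ξ)‖ =
      ‖ξ‖ * defect η p (scaleParams l) := by
  have hr := (scale_pos hl).ne'
  rw [heisEmbedding, norm_twistedEmbedding_piRep_sub,
    l2modulate_l2translate_l2dilate (div_scale_ne_zero hl) (continuous_defectPhase l p)
      (θ' := fun z : Rn n => 2 * Real.pi * ((scaleParams l).2.1 * inner ℝ p.x z +
        (scaleParams l).1 * (p.t - inner ℝ p.x p.y / 2))) (by fun_prop),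
    ← l2dilate_sub, norm_l2dilate]
  · rfl
  · intro y
    simp only [scaleParams, real_inner_smul_right]
    field_simp

end Defect

/-! ### The limit `λ → 0` -/

section Limit

/-- If an isometry `W` intertwines two families of isometries up to an error `δ`, then it
compresses one integrated form to the other up to the error `∫ ‖f‖ δ`. -/
theorem norm_integratedForm_sub_compress_le {X : Type} [TopologicalSpace X]
    [SecondCountableTopology X] [MeasurableSpace X] [OpensMeasurableSpace X] {H K : Type*}
    [NormedAddCommGroup H] [InnerProductSpace ℂ H] [CompleteSpace H] [NormedAddCommGroup K]
    [InnerProductSpace ℂ K] [CompleteSpace K] (μ : Measure X) (U : X → H →ₗᵢ[ℂ] H)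
    (hU : ∀ ξ, Continuous fun x => U x ξ) (V : X → K →ₗᵢ[ℂ] K)
    (hV : ∀ ξ, Continuous fun x => V x ξ) (W : H →ₗᵢ[ℂ] K) (f : Lp ℂ 1 μ) {δ : X → ℝ}
    (hδ : ∀ x ξ, ‖W (U x ξ) - V x (W ξ)‖ ≤ ‖ξ‖ * δ x) (hδ0 : ∀ x, 0 ≤ δ x)
    (hI : Integrable (fun x => ‖f x‖ * δ x) μ) :
    ‖integratedForm μ U hU f - ContinuousLinearMap.adjoint W.toContinuousLinearMap ∘L
      integratedForm μ V hV f ∘L W.toContinuousLinearMap‖ ≤ ∫ x, ‖f x‖ * δ x ∂μ := by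
  -- As `W* W = 1`, the difference is `W* (W U(f) - V(f) W)`, and `W*` is a contraction.
  set A := ContinuousLinearMap.adjoint W.toContinuousLinearMap
  have hA : ‖A‖ ≤ 1 := by
    rw [LinearIsometryEquiv.norm_map]
    exact W.norm_toContinuousLinearMap_le
  have hAW (ξ : H) : A (W ξ) = ξ := by
    refine ext_inner_left ℂ fun ζ => ?_
    rw [ContinuousLinearMap.adjoint_inner_right]
    exact W.inner_map_map ζ ξ
  refine ContinuousLinearMap.opNorm_le_bound _
    (integral_nonneg fun x => mul_nonneg (norm_nonneg _) (hδ0 x)) fun ξ => ?_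
  have hf := L1.integrable_coeFn f
  have h1 := integrable_smul_isometry μ U hU hf ξ
  have h2 := integrable_smul_isometry μ V hV hf (W ξ)
  have h3 : W (integratedForm μ U hU f ξ) = ∫ x, W (f x • U x ξ) ∂μ := by
    rw [integratedForm_apply]
    exact (W.toContinuousLinearMap.integral_comp_comm h1).symm
  have h4 : Integrable (fun x => W (f x • U x ξ)) μ := W.toContinuousLinearMap.integrable_comp h1
  have h5 : ‖W (integratedForm μ U hU f ξ) - integratedForm μ V hV f (W ξ)‖ ≤
      (∫ x, ‖f x‖ * δ x ∂μ) * ‖ξ‖ := by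
    rw [h3, integratedForm_apply, ← integral_sub h4 h2, ← integral_mul_const]
    refine norm_integral_le_of_norm_le (hI.mul_const _) (Eventually.of_forall fun x => ?_)
    rw [map_smul, ← smul_sub, norm_smul, mul_assoc, mul_comm (δ x)]
    exact mul_le_mul_of_nonneg_left (hδ x ξ) (norm_nonneg _)
  have h6 : (integratedForm μ U hU f - A ∘L integratedForm μ V hV f ∘L W.toContinuousLinearMap) ξ =
      A (W (integratedForm μ U hU f ξ) - integratedForm μ V hV f (W ξ)) := by
    rw [map_sub, hAW]
    rfl
  rw [h6]
  refine (A.le_opNorm _).trans ((mul_le_of_le_one_left (norm_nonneg _) hA).trans h5)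

/-- The extension of a unitary representation to the group `C*`-algebra is contractive. -/
theorem UnitaryRep.norm_lift_le {G : Type} [Group G] [TopologicalSpace G]
    [SecondCountableTopology G] [MeasurableSpace G] [OpensMeasurableSpace G] {H : Type}
    [NormedAddCommGroup H] [InnerProductSpace ℂ H] [CompleteSpace H] (π : UnitaryRep G H)
    (μ : Measure G) (a : GroupCStar μ) : ‖π.lift μ a‖ ≤ ‖a‖ := by
  induction a using UniformSpace.Completion.induction_on with
  | hp => exact isClosed_le (π.lift μ).continuous.norm continuous_norm
  | ih f =>
    have h := UnitaryRep.lift_ofL1 π μ f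
    rw [UniformSpace.Completion.norm_coe]
    refine (congrArg norm h).trans_le ?_
    exact le_csSup (repNorms_bddAbove μ f) ⟨H, _, _, inferInstance, π, rfl⟩

variable {n : ℕ}

theorem norm_compression_le {η : 𝓢(Rn n, ℂ)} (hη : ∫ s, ‖η s‖ ^ 2 = 1) {l : ℝ} (hl : l ≠ 0)
    (T : CStarR2n n) : ‖compression hη hl T‖ ≤ ‖T‖ := by
  have hW := (heisEmbedding hη hl).norm_toContinuousLinearMap_le
  rw [compression_apply]
  refine (ContinuousLinearMap.opNorm_comp_le _ _).trans ?_
  rw [LinearIsometryEquiv.norm_map]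
  refine (mul_le_of_le_one_left (norm_nonneg _) hW).trans ?_
  exact (ContinuousLinearMap.opNorm_comp_le _ _).trans
    (mul_le_of_le_one_right (norm_nonneg _) hW)

theorem norm_piRep_lift_sub_le {η : 𝓢(Rn n, ℂ)} (hη : ∫ s, ‖η s‖ ^ 2 = 1) {l : ℝ} (hl : l ≠ 0)
    (a : HeisCStar n) : ‖(piRep n l).lift volume a - compression hη hl (rho n a)‖ ≤ 2 * ‖a‖ := by
  have h1 := (piRep n l).norm_lift_le volume a
  have h2 := (norm_compression_le hη hl (rho n a)).trans ((rhoRep n).norm_lift_le volume a)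
  linarith [norm_sub_le ((piRep n l).lift volume a) (compression hη hl (rho n a))]

theorem aestronglyMeasurable_defect (η : 𝓢(Rn n, ℂ)) (q : ℝ × ℝ × ℝ) :
    AEStronglyMeasurable (fun p : Heis n => defect η p q) volume := by
  have h : Continuous fun p : Heis n => defect η p q :=
    (continuous_defect η).comp (f := fun p : Heis n => (p, q)) (by fun_prop)
  exact h.aestronglyMeasurable

theorem integrable_norm_mul_defect {η : 𝓢(Rn n, ℂ)} (hη : ∫ s, ‖η s‖ ^ 2 = 1)
    (f : Lp ℂ 1 (volume : Measure (Heis n))) (q : ℝ × ℝ × ℝ) :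
    Integrable (fun p => ‖f p‖ * defect η p q) volume :=
  (L1.integrable_coeFn f).norm.mul_bdd (aestronglyMeasurable_defect η q) (c := 2)
    (Eventually.of_forall fun p => by
      have h : 0 ≤ defect η p q := norm_nonneg _
      rw [Real.norm_of_nonneg h]
      exact defect_le_two hη p q)

theorem tendsto_integral_norm_mul_defect {η : 𝓢(Rn n, ℂ)} (hη : ∫ s, ‖η s‖ ^ 2 = 1)
    (f : Lp ℂ 1 (volume : Measure (Heis n))) :
    Tendsto (fun q => ∫ p, ‖f p‖ * defect η p q) (𝓝 0) (𝓝 0) := by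
  have h0 : (0 : ℝ) = ∫ p, ‖f p‖ * defect η p 0 := by simp [defect_zero]
  rw [h0]
  refine tendsto_integral_filter_of_dominated_convergence (fun p => ‖f p‖ * 2)
    (Eventually.of_forall fun q => (integrable_norm_mul_defect hη f q).1)
    (Eventually.of_forall fun q => Eventually.of_forall fun p => ?_)
    ((L1.integrable_coeFn f).norm.mul_const 2) (Eventually.of_forall fun p => ?_)
  · have h1 : 0 ≤ defect η p q := norm_nonneg _
    rw [Real.norm_of_nonneg (by positivity)]
    exact mul_le_mul_of_nonneg_left (defect_le_two hη p q) (norm_nonneg _)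
  · have h : Continuous fun q => defect η p q :=
      (continuous_defect η).comp (f := fun q : ℝ × ℝ × ℝ => (p, q)) (by fun_prop)
    exact (h.tendsto 0).const_mul _

theorem norm_piRep_lift_ofL1_sub_le {η : 𝓢(Rn n, ℂ)} (hη : ∫ s, ‖η s‖ ^ 2 = 1) {l : ℝ}
    (hl : l ≠ 0) (f : Lp ℂ 1 (volume : Measure (Heis n))) :
    ‖(piRep n l).lift volume (GroupCStar.ofL1 volume f) -
        compression hη hl (rho n (GroupCStar.ofL1 volume f))‖ ≤
      ∫ p, ‖f p‖ * defect η p (scaleParams l) := by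
  have h1 : ((rho n (GroupCStar.ofL1 volume f) : CStarR2n n) : L2R2n n →L[ℂ] L2R2n n) =
      (rhoRep n).integrated volume f := UnitaryRep.lift_ofL1 (rhoRep n) volume f
  rw [UnitaryRep.lift_ofL1, compression_apply, h1]
  exact norm_integratedForm_sub_compress_le volume
    (fun g => ((piRep n l).toHom g).toLinearIsometry) (piRep n l).continuous_apply
    (fun g => ((rhoRep n).toHom g).toLinearIsometry) (rhoRep n).continuous_apply
    (heisEmbedding hη hl) f (fun p ξ => (norm_heisEmbedding_piRep_sub hη hl p ξ).le)
    (fun p => norm_nonneg _) (integrable_norm_mul_defect hη f _)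

theorem tendsto_norm_piRep_lift_sub_compression {η : 𝓢(Rn n, ℂ)} (hη : ∫ s, ‖η s‖ ^ 2 = 1)
    (a : HeisCStar n) :
    Tendsto (fun l : {l : ℝ // l ≠ 0} =>
      ‖(piRep n l).lift volume a - compression hη l.2 (rho n a)‖)
      (comap Subtype.val (𝓝 0)) (𝓝 0) := by
  rw [Metric.tendsto_nhds]
  intro ε hε
  obtain ⟨f, hf⟩ : ∃ f : Lp ℂ 1 (volume : Measure (Heis n)),
      dist a (GroupCStar.ofL1 volume f) < ε / 4 :=
    (UniformSpace.Completion.denseRange_coe (α := L1CStar (volume : Measure (Heis n)))).exists_dist_lt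
      a (by positivity)
  set b := GroupCStar.ofL1 volume f
  filter_upwards [((tendsto_integral_norm_mul_defect hη f).comp
    tendsto_scaleParams).eventually_lt_const (half_pos hε)] with l hl
  have h1 := norm_piRep_lift_ofL1_sub_le hη l.2 f
  have h2 := norm_piRep_lift_sub_le hη l.2 (a - b)
  have h3 : (piRep n l).lift volume a - compression hη l.2 (rho n a) =
      ((piRep n l).lift volume (a - b) - compression hη l.2 (rho n (a - b))) +
        ((piRep n l).lift volume b - compression hη l.2 (rho n b)) := by
    simp only [map_sub]
    abel
  have h4 := norm_add_le ((piRep n l).lift volume (a - b) - compression hη l.2 (rho n (a - b)))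
    ((piRep n l).lift volume b - compression hη l.2 (rho n b))
  rw [← h3] at h4
  rw [dist_eq_norm] at hf
  rw [dist_zero_right, norm_norm]
  simp only [Function.comp_apply] at hl
  linarith

end Limit

theorem theorem2 (n : ℕ) (hn : 1 ≤ n) (η : 𝓢(Rn n, ℂ)) (hη : ∫ s, ‖η s‖ ^ 2 = 1) :
    (∀ (l : ℝ) (hl : l ≠ 0) (h : 𝓢(R2n n, ℂ)),
      Integrable (nuIntegrand η hl h) volume ∧
      nu η hl (toCStarR2n n (h.toLp 1 volume)) = ∫ u, nuIntegrand η hl h u) ∧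
    ∀ a : HeisCStar n,
      Tendsto (fun l : {l : ℝ // l ≠ 0} =>
          ‖(piRep n l).lift volume a - nu η l.2 (rho n a)‖)
        (comap Subtype.val (𝓝 0)) (𝓝 0) := by
  refine ⟨fun l hl h => ⟨integrable_nuIntegrand hη hl h, ?_⟩, fun a => ?_⟩
  · rw [nu_eq_compression hη hl, compression_schwartz]
  · simp only [fun l : {l : ℝ // l ≠ 0} => nu_eq_compression hη l.2]
    exact tendsto_norm_piRep_lift_sub_compression hη a
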